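/- **Setting.** Let $H\neq\{0\}$ be a real separable Hilbert space, identified with its dual, and let $S(H)$ be the space of bounded self-adjoint operators on $H$ with the operator norm. For $v\in C^2(H)$ regard $Dv(x)\in H$ and $D^2v(x)\in S(H)$. Let $L\colon D(L)\subset H\to H$ be a closed, densely defined linear operator, let $\{e_i\}_{i\ge1}\subset D(L)$ be an orthonormal basis of $H$ (finite if $\dim H<\infty$), and let $P_dx=\sum_{i\le d}\langle x,e_i\rangle e_i$ (with $P_d=I$ if $d>\dim H$) and $\mathcal E_d(x)=(\langle x,e_i\rangle)_{i\le d}\in\mathbb R^d$. Let $F\colon H\times\mathbb R\times H\times S(H)\to\mathbb R$ and put $$(\mathcal Fv)(x)=\langle LDv(x),x\rangle+F(x,v(x),Dv(x),D^2v(x)).$$ **Assumptions on $F$.** $F$ is continuous and there are $C>0$, $k\ge0$ with $$|F(x,v,p,Z)-F(x,r,q,Y)|\le C\,(|v-r|+|p-q|+\|Z-Y\|)\,(1+|x|^k)$$ for all arguments. Moreover $F$ is sequentially continuous when $S(H)$ carries the compact-open topology: if $x^n\to x$, $v^n\to v$, $p^n\to p$ and $\sup_{h\in K}|(Y^n-Y)h|\to0$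 for every compact $K\subset H$, then $F(x^n,v^n,p^n,Y^n)\to F(x,v,p,Y)$. (Equivalently, the strong operator topology may be used.) **Solution.** Let $v\in C^2(H)$ be a classical solution of $\mathcal Fv=0$ on $H$, i.e. $Dv(x)\in D(L)$ for all $x$, $LDv\in C(H;H)$, and $(\mathcal Fv)(x)=0$ for all $x\in H$. **HGNOs.** For each integer $d\ge1$ let $\{\tilde v^{d,\theta}\}_{\theta\in\Theta_d}\subset C^2(\mathbb R^d)$ be a class of functions, and put $v^{d,\theta}:=\tilde v^{d,\theta}\circ\mathcal E_d\colon H\to\mathbb R$ for $1\le d\le\dim H$. Then $v^{d,\theta}\in C^2(H)$ and $Dv^{d,\theta}$ takes values in $D(L)$. **(i)** Suppose that for every $d\ge1$ the class $\{\tilde v^{d,\theta}\}_\theta$ is dense in $C^2(\mathbb R^d)$ for uniform convergence on compact sets of the function, its gradient and its Hessian. Let $K,K'\subset H$ be compact and assume $$\sup_{x\in K}|\langle L[Dv(x)-P_dDv(P_dx)],x\rangle|\xrightarrow{d\to\infty}0 .$$ Then for every $\varepsilon>0$ there are $1\le d\le\dim H$ and $\theta\in\Theta_d$ such that, simultaneously,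 $$\sup_{x\in K}|v-v^{d,\theta}|<\varepsilon,\quad \sup_{x\in K}|Dv-Dv^{d,\theta}|<\varepsilon,\quad \sup_{x\in K,h\in K'}|[D^2v(x)-D^2v^{d,\theta}(x)]h|<\varepsilon,$$ $$\sup_{x\in K}|\langle L[Dv(x)-Dv^{d,\theta}(x)],x\rangle|<\varepsilon,\qquad \sup_{x\in K}|(\mathcal Fv^{d,\theta})(x)|<\varepsilon .$$ **(ii)** Suppose that for every $d\ge1$, every finite Borel measure $\nu$ on $\mathbb R^d$, every $h\in C^2(\mathbb R^d)$ with $\|h\|_{W^{2,4}(\mathbb R^d;\nu)}<\infty$ and every $\varepsilon>0$ there is $\theta\in\Theta_d$ with $\|h-\tilde v^{d,\theta}\|_{W^{2,4}(\mathbb R^d;\nu)}<\varepsilon$. With $k$ as above, assume that for some $C>0$ $$|v(x)|+|Dv(x)|+\|D^2v(x)\|\le C(1+|x|^k)\qquad\text{for all }x\in H .$$ Let $\mu,\mu'$ be Borel probability measures on $H$ with $\int_H|x|^{4k}\mu(dx)<\infty$, $\int_H|x|^4\mu(dx)<\infty$ and $\int_H|h|^4\mu'(dh)<\infty$, and assume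 $$\int_H|\langle L[Dv(x)-P_dDv(P_dx)],x\rangle|^2\mu(dx)\xrightarrow{d\to\infty}0 .$$ Then for every $\varepsilon>0$ there are $1\le d\le\dim H$ and $\theta\in\Theta_d$ such that, simultaneously, $$\int_H|v-v^{d,\theta}|^4d\mu<\varepsilon,\quad \int_H|Dv-Dv^{d,\theta}|^4d\mu<\varepsilon,\quad \int_{H\times H}|[D^2v(x)-D^2v^{d,\theta}(x)]h|^4\mu(dx)\mu'(dh)<\varepsilon,$$ $$\int_H|\langle L[Dv(x)-Dv^{d,\theta}(x)],x\rangle|^2\mu(dx)<\varepsilon,\qquad \int_H|(\mathcal Fv^{d,\theta})(x)|^2\mu(dx)<\varepsilon .$$ -/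

import Mathlib

open MeasureTheory Filter Topology
open scoped ENNReal Gradient RealInnerProductSpace

noncomputable section

/-- The space `S(H)` of bounded self-adjoint operators on `H`, with the operator norm. -/
abbrev SymOp (H : Type*) [NormedAddCommGroup H] [InnerProductSpace ℝ H] [CompleteSpace H] :
    Type _ :=
  selfAdjoint (H →L[ℝ] H)

section Hilbert

variable {H : Type*} [NormedAddCommGroup H] [InnerProductSpace ℝ H] [CompleteSpace H]

/-- The Hessian of `v` at `x` as a bounded operator: the Fréchet derivative at `x` of the gradient
`∇ v : H → H` (`∇ v x` is the Riesz representative of the Fréchet derivative of `v` at `x`). -/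
def hessOp (v : H → ℝ) (x : H) : H →L[ℝ] H := fderiv ℝ (∇ v) x

theorem inner_hessOp {v : H → ℝ} (hv : ContDiff ℝ 2 v) (x h k : H) :
    ⟪hessOp v x h, k⟫ = fderiv ℝ (fderiv ℝ v) x h k := by
  have h1 : DifferentiableAt ℝ (fderiv ℝ v) x :=
    ((hv.fderiv_right (m := 1) (by norm_num)).differentiable one_ne_zero) x
  have h2 : hessOp v x h = (InnerProductSpace.toDual ℝ H).symm (fderiv ℝ (fderiv ℝ v) x h) := by
    have h3 := ((InnerProductSpace.toDual ℝ H).symm.toContinuousLinearEquiv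
      : _ ≃L[ℝ] H).hasFDerivAt.comp x h1.hasFDerivAt
    have h4 : hessOp v x = _ := h3.fderiv
    rw [h4]
    rfl
  rw [h2, InnerProductSpace.toDual_symm_apply]

theorem isSelfAdjoint_hessOp {v : H → ℝ} (hv : ContDiff ℝ 2 v) (x : H) :
    IsSelfAdjoint (hessOp v x) := by
  rw [ContinuousLinearMap.isSelfAdjoint_iff_isSymmetric]
  intro h k
  have hs : IsSymmSndFDerivAt ℝ v x :=
    hv.contDiffAt.isSymmSndFDerivAt (by simp)
  have h1 := inner_hessOp hv x h k
  have h2 := inner_hessOp hv x k h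
  have h3 : fderiv ℝ (fderiv ℝ v) x h k = fderiv ℝ (fderiv ℝ v) x k h := hs h k
  simp only [ContinuousLinearMap.coe_coe]
  rw [h1, h3, ← h2, real_inner_comm]

/-- The Hessian `D²v(x)` as an element of `S(H)`. The self-adjoint part is taken only to have a
total function; for `v` of class `C²` it is `hessOp v x` itself, see `coe_hess`. -/
def hess (v : H → ℝ) (x : H) : SymOp H := selfAdjointPart ℝ (hessOp v x)

theorem coe_hess {v : H → ℝ} (hv : ContDiff ℝ 2 v) (x : H) :
    (hess v x : H →L[ℝ] H) = hessOp v x :=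
  (isSelfAdjoint_hessOp hv x).coe_selfAdjointPart_apply ℝ

open Classical in
/-- The value `L y` of an unbounded operator, set to `0` outside the domain of `L`. -/
def opApply (L : H →ₗ.[ℝ] H) (y : H) : H :=
  if h : y ∈ L.domain then L ⟨y, h⟩ else 0

/-- The residual `⟨L Dv(x), x⟩ + F(x, v(x), Dv(x), D²v(x))` of the equation. -/
def pdeResidual (L : H →ₗ.[ℝ] H) (F : H → ℝ → H → SymOp H → ℝ) (v : H → ℝ) (x : H) : ℝ :=
  ⟪opApply L (∇ v x), x⟫ + F x (v x) (∇ v x) (hess v x)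

/-- Classical solutions of `⟨L Dv, x⟩ + F(x, v, Dv, D²v) = 0` on `H`. -/
structure IsClassicalSolution (L : H →ₗ.[ℝ] H) (F : H → ℝ → H → SymOp H → ℝ) (v : H → ℝ) :
    Prop where
  contDiff : ContDiff ℝ 2 v
  gradient_mem : ∀ x, ∇ v x ∈ L.domain
  continuous_op : Continuous fun x => opApply L (∇ v x)
  equation : ∀ x, pdeResidual L F v x = 0

/-- `F` is continuous (for the operator norm on `S(H)`) and Lipschitz in `(v, p, Z)` with a constant
growing like `1 + |x|^k`. -/
def LipschitzWithWeight (F : H → ℝ → H → SymOp H → ℝ) (k : ℝ) : Prop :=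
  Continuous (fun z : H × ℝ × H × SymOp H => F z.1 z.2.1 z.2.2.1 z.2.2.2) ∧
  ∃ C : ℝ, 0 < C ∧ ∀ (x : H) (v r : ℝ) (p q : H) (Z Y : SymOp H),
    |F x v p Z - F x r q Y| ≤ C * (|v - r| + ‖p - q‖ + ‖Z - Y‖) * (1 + ‖x‖ ^ k)

/-- Sequential continuity of `F` when `S(H)` carries the compact-open topology, i.e. the topology of
uniform convergence on compact subsets of `H`. -/
def SeqContinuousCompactOpen (F : H → ℝ → H → SymOp H → ℝ) : Prop :=
  ∀ (xs : ℕ → H) (x : H) (vs : ℕ → ℝ) (v : ℝ) (ps : ℕ → H) (p : H)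
    (Ys : ℕ → SymOp H) (Y : SymOp H),
    Tendsto xs atTop (𝓝 x) → Tendsto vs atTop (𝓝 v) → Tendsto ps atTop (𝓝 p) →
    (∀ K : Set H, IsCompact K →
      TendstoUniformlyOn (fun n h => (Ys n : H →L[ℝ] H) h) (fun h => (Y : H →L[ℝ] H) h) atTop K) →
    Tendsto (fun n => F (xs n) (vs n) (ps n) (Ys n)) atTop (𝓝 (F x v p Y))

/-- `e 0, e 1, …` lists an orthonormal basis of the Hilbert space `H`, whose dimension is `N`
(`N = ⊤`: countably infinite). If `N` is finite the list is continued by zeros. -/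
structure IsOrthonormalBasisSeq (e : ℕ → H) (N : ℕ∞) : Prop where
  orthonormal : Orthonormal ℝ (fun i : {i : ℕ // (i : ℕ∞) < N} => e i)
  dense_span : (Submodule.span ℝ (Set.range e)).topologicalClosure = ⊤
  eq_zero : ∀ i : ℕ, N ≤ (i : ℕ∞) → e i = 0

/-- The coordinate operator `x ↦ (⟨x, e_i⟩)_{i < d}` from `H` to `ℝ^d`. -/
def coordMap (e : ℕ → H) (d : ℕ) (x : H) : EuclideanSpace ℝ (Fin d) :=
  WithLp.toLp 2 fun i => ⟪x, e i⟫

/-- The orthogonal projection `P_d` onto the span of the first `d` basis vectors. -/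
def projMap (e : ℕ → H) (d : ℕ) (x : H) : H := ∑ i ∈ Finset.range d, ⟪x, e i⟫ • e i

/-- The real-valued Hilbert--Galerkin neural operator built on the finite-dimensional function
`f : ℝ^d → ℝ`. -/
def hgno (e : ℕ → H) {d : ℕ} (f : EuclideanSpace ℝ (Fin d) → ℝ) (x : H) : ℝ :=
  f (coordMap e d x)

/-- `⟨L[Dv(x) - P_d Dv(P_d x)], x⟩`. -/
def consistencyError (L : H →ₗ.[ℝ] H) (e : ℕ → H) (v : H → ℝ) (d : ℕ) (x : H) : ℝ :=
  ⟪opApply L (∇ v x - projMap e d (∇ v (projMap e d x))), x⟫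

end Hilbert

/-- For every `d ≥ 1` the functions `net d θ : ℝ^d → ℝ` are dense in `C²(ℝ^d)`, for uniform
convergence on compact sets of the function, its gradient and its Hessian. -/
def UniversalOnCompacts {Θ : ℕ → Type*} (net : (d : ℕ) → Θ d → EuclideanSpace ℝ (Fin d) → ℝ) :
    Prop :=
  ∀ d : ℕ, 1 ≤ d → ∀ h : EuclideanSpace ℝ (Fin d) → ℝ, ContDiff ℝ 2 h →
    ∀ K : Set (EuclideanSpace ℝ (Fin d)), IsCompact K → ∀ ε : ℝ, 0 < ε →
      ∃ θ : Θ d, ∀ y ∈ K, |h y - net d θ y| < ε ∧ ‖∇ (fun z => h z - net d θ z) y‖ < ε ∧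
        ‖hessOp (fun z => h z - net d θ z) y‖ < ε

/-- The `w`-th power of the Sobolev norm of `W^{2,w}(ℝ^d; μ)`, for `f` of class `C²`. -/
def sobolevNormPow {d : ℕ} (w : ℕ) (μ : Measure (EuclideanSpace ℝ (Fin d)))
    (f : EuclideanSpace ℝ (Fin d) → ℝ) : ℝ≥0∞ :=
  ∫⁻ y, (‖f y‖ₑ ^ w + ‖∇ f y‖ₑ ^ w + ‖hessOp f y‖ₑ ^ w) ∂μ

/-- For every `d ≥ 1` and every finite measure `μ` on `ℝ^d`, every `C²` function of finite
`W^{2,w}(μ)`-norm is approximated in that norm by the functions `net d θ : ℝ^d → ℝ`. -/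
def UniversalInSobolev {Θ : ℕ → Type*} (w : ℕ)
    (net : (d : ℕ) → Θ d → EuclideanSpace ℝ (Fin d) → ℝ) : Prop :=
  ∀ d : ℕ, 1 ≤ d → ∀ μ : Measure (EuclideanSpace ℝ (Fin d)), IsFiniteMeasure μ →
    ∀ h : EuclideanSpace ℝ (Fin d) → ℝ, ContDiff ℝ 2 h → sobolevNormPow w μ h < ∞ →
      ∀ ε : ℝ, 0 < ε →
        ∃ θ : Θ d, sobolevNormPow w μ (fun y => h y - net d θ y) < ENNReal.ofReal ε

end

/-! The approximation passes through the Galerkin truncation `v ∘ P_d`, and `d` is fixed before `θ`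
is chosen.

Truncation. Its gradient is `P_d Dv(P_d x)` and its Hessian `P_d D²v(P_d x) P_d`. The `P_d` are
contractions tending strongly to the identity, so values and gradients converge jointly in `(d, x)`,
which on compact sets means uniformly. In infinite dimension `P_d` does not tend to the identity in
operator norm, so the Hessians are controlled only after application to vectors; this is why `F`
must be continuous for the compact-open topology (`tendsto_nonlinearity_trunc`). Nothing makes `L`
commute with these limits: the drift error of the truncation is exactly the consistency error, which
tends to zero by hypothesis.

Finite dimension. Let `E_d` be the coordinate map. Since `P_d = E_d* E_d`, the truncation is the
function `v ∘ E_d*` on `ℝ^d` composed with `E_d`, so it can be compared with `v^{d,θ}` through the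
gap `v ∘ E_d* - f` alone. Pulling back by `E_d` does not increase norms, `L ∘ E_d*` is bounded
because its source is finite-dimensional, and `F` is Lipschitz. Its bound may blow up with `d`,
which is harmless because `θ` comes last. Subtracting the equation for `v` reduces the residual to
differences of `F` and of the drift (`pdeResidual_hgno`).

For (i), density is used on the compact set `E_d(K)`. For (ii), it is used for the law of `E_d`
under `μ`; dominated convergence replaces uniform convergence, with a majorant from the growth of
`v`, and Cauchy-Schwarz turns fourth-power bounds on the gap into square bounds on drift and
residual. -/

noncomputable section

set_option linter.unusedSectionVars false

/-! ### Gradients and Hessians under composition with bounded operators -/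

section Calculus

variable {X Y : Type*} [NormedAddCommGroup X] [InnerProductSpace ℝ X] [CompleteSpace X]
  [NormedAddCommGroup Y] [InnerProductSpace ℝ Y] [CompleteSpace Y]

theorem gradient_comp_clm {f : Y → ℝ} (hf : Differentiable ℝ f) (A : X →L[ℝ] Y) (x : X) :
    ∇ (fun z => f (A z)) x = A.adjoint (∇ f (A x)) := by
  have h1 : fderiv ℝ (fun z => f (A z)) x = (fderiv ℝ f (A x)).comp A :=
    ((hf (A x)).hasFDerivAt.comp x A.hasFDerivAt).fderiv
  refine ext_inner_right ℝ fun z => ?_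
  rw [ContinuousLinearMap.adjoint_inner_left]
  simp only [gradient, InnerProductSpace.toDual_symm_apply]
  rw [h1]
  rfl

theorem contDiff_gradient {f : X → ℝ} (hf : ContDiff ℝ 2 f) : ContDiff ℝ 1 (∇ f) :=
  (InnerProductSpace.toDual ℝ X).symm.toContinuousLinearEquiv.contDiff.comp
    (hf.fderiv_right (m := 1) (by norm_num))

theorem continuous_gradient {f : X → ℝ} (hf : ContDiff ℝ 2 f) : Continuous (∇ f) :=
  (contDiff_gradient hf).continuous

theorem continuous_hessOp {f : X → ℝ} (hf : ContDiff ℝ 2 f) : Continuous (hessOp f) :=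
  (contDiff_gradient hf).continuous_fderiv one_ne_zero

theorem continuous_hess {f : X → ℝ} (hf : ContDiff ℝ 2 f) : Continuous (hess f) := by
  rw [continuous_induced_rng]
  exact (continuous_hessOp hf).congr fun x => (coe_hess hf x).symm

theorem hessOp_comp_clm {f : Y → ℝ} (hf : ContDiff ℝ 2 f) (A : X →L[ℝ] Y) (x : X) :
    hessOp (fun z => f (A z)) x = A.adjoint ∘L hessOp f (A x) ∘L A := by
  have h1 : ∇ (fun z => f (A z)) = fun x => A.adjoint (∇ f (A x)) :=
    funext (gradient_comp_clm (hf.differentiable two_ne_zero) A)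
  have h2 : DifferentiableAt ℝ (∇ f) (A x) :=
    (contDiff_gradient hf).differentiable one_ne_zero _
  rw [hessOp, h1]
  exact (A.adjoint.hasFDerivAt.comp x (h2.hasFDerivAt.comp x A.hasFDerivAt)).fderiv

theorem gradient_sub_fun {f g : X → ℝ} (hf : ContDiff ℝ 2 f) (hg : ContDiff ℝ 2 g) (x : X) :
    ∇ (fun z => f z - g z) x = ∇ f x - ∇ g x := by
  simp only [gradient]
  rw [fderiv_fun_sub (hf.differentiable two_ne_zero x) (hg.differentiable two_ne_zero x), map_sub]

theorem hessOp_sub_fun {f g : X → ℝ} (hf : ContDiff ℝ 2 f) (hg : ContDiff ℝ 2 g) (x : X) :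
    hessOp (fun z => f z - g z) x = hessOp f x - hessOp g x := by
  have h1 : ∇ (fun z => f z - g z) = fun z => ∇ f z - ∇ g z :=
    funext (gradient_sub_fun hf hg)
  rw [hessOp, h1]
  exact fderiv_fun_sub ((contDiff_gradient hf).differentiable one_ne_zero x)
    ((contDiff_gradient hg).differentiable one_ne_zero x)

theorem norm_hess_sub {f g : X → ℝ} (hf : ContDiff ℝ 2 f) (hg : ContDiff ℝ 2 g) (x : X) :
    ‖hess f x - hess g x‖ = ‖hessOp f x - hessOp g x‖ := by
  rw [← coe_hess hf, ← coe_hess hg]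
  rfl

end Calculus

/-! ### Coordinate maps and Galerkin projections -/

section Projection

variable {H : Type*} [NormedAddCommGroup H] [InnerProductSpace ℝ H] [CompleteSpace H]
  {e : ℕ → H} {N : ℕ∞}

/-- The coordinate operator as a bounded operator. -/
def coordL (e : ℕ → H) (d : ℕ) : H →L[ℝ] EuclideanSpace ℝ (Fin d) :=
  (EuclideanSpace.equiv (Fin d) ℝ).symm.toContinuousLinearMap ∘L
    ContinuousLinearMap.pi fun i : Fin d => innerSL ℝ (e i)

theorem coordL_apply (e : ℕ → H) (d : ℕ) (x : H) : coordL e d x = coordMap e d x := by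
  ext i
  simp [coordL, coordMap, real_inner_comm]

theorem coordL_apply_apply (e : ℕ → H) (d : ℕ) (x : H) (i : Fin d) :
    coordL e d x i = ⟪x, e i⟫ := by
  rw [coordL_apply]; rfl

theorem adjoint_coordL_apply (e : ℕ → H) (d : ℕ) (y : EuclideanSpace ℝ (Fin d)) :
    (coordL e d).adjoint y = ∑ i : Fin d, y i • e i := by
  refine ext_inner_right ℝ fun x => ?_
  rw [ContinuousLinearMap.adjoint_inner_left, sum_inner, PiLp.inner_apply]
  refine Finset.sum_congr rfl fun i _ => ?_
  rw [coordL_apply_apply, inner_smul_left, real_inner_comm (e i) x]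
  simp [mul_comm]

/-- The orthogonal projection onto the first `d` basis vectors as a bounded operator. -/
def projL (e : ℕ → H) (d : ℕ) : H →L[ℝ] H := (coordL e d).adjoint ∘L coordL e d

theorem projL_apply (e : ℕ → H) (d : ℕ) (x : H) : projL e d x = projMap e d x := by
  rw [projL, ContinuousLinearMap.comp_apply, adjoint_coordL_apply, projMap,
    ← Fin.sum_univ_eq_sum_range (fun i => ⟪x, e i⟫ • e i)]
  exact Finset.sum_congr rfl fun i _ => by rw [coordL_apply_apply]

theorem adjoint_projL (e : ℕ → H) (d : ℕ) : (projL e d).adjoint = projL e d := by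
  rw [projL, ContinuousLinearMap.adjoint_comp, ContinuousLinearMap.adjoint_adjoint]

namespace IsOrthonormalBasisSeq

theorem inner_eq (he : IsOrthonormalBasisSeq e N) (i j : ℕ) (hij : i ≠ j) : ⟪e i, e j⟫ = 0 := by
  rcases lt_or_ge (i : ℕ∞) N with hi | hi
  · rcases lt_or_ge (j : ℕ∞) N with hj | hj
    · exact he.orthonormal.2 (i := ⟨i, hi⟩) (j := ⟨j, hj⟩) (by simpa using hij)
    · rw [he.eq_zero j hj, inner_zero_right]
  · rw [he.eq_zero i hi, inner_zero_left]

theorem inner_smul_self (he : IsOrthonormalBasisSeq e N) (i : ℕ) : ⟪e i, e i⟫ • e i = e i := by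
  rcases lt_or_ge (i : ℕ∞) N with hi | hi
  · have := he.orthonormal.1 ⟨i, hi⟩
    simp only at this
    rw [real_inner_self_eq_norm_sq, this]; simp
  · rw [he.eq_zero i hi, smul_zero]

theorem projL_basis (he : IsOrthonormalBasisSeq e N) {d i : ℕ} (hi : i < d) :
    projL e d (e i) = e i := by
  rw [projL_apply, projMap, Finset.sum_eq_single i, he.inner_smul_self]
  · intro j _ hj
    rw [he.inner_eq i j hj.symm, zero_smul]
  · intro h
    exact absurd (Finset.mem_range.2 hi) h

theorem projL_projL (he : IsOrthonormalBasisSeq e N) (d : ℕ) (x : H) :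
    projL e d (projL e d x) = projL e d x := by
  conv_lhs => rw [projL_apply e d x, projMap, map_sum]
  rw [projL_apply, projMap]
  refine Finset.sum_congr rfl fun i hi => ?_
  rw [map_smul, he.projL_basis (Finset.mem_range.1 hi)]

theorem norm_projL_apply_le (he : IsOrthonormalBasisSeq e N) (d : ℕ) (x : H) :
    ‖projL e d x‖ ≤ ‖x‖ := by
  have h1 : ‖projL e d x‖ ^ 2 ≤ ‖x‖ * ‖projL e d x‖ := by
    rw [← real_inner_self_eq_norm_sq]
    conv_lhs => rw [← adjoint_projL, ContinuousLinearMap.adjoint_inner_left, adjoint_projL,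
      he.projL_projL]
    exact real_inner_le_norm _ _
  nlinarith [norm_nonneg (projL e d x), norm_nonneg x]

theorem norm_coordL_apply_le (he : IsOrthonormalBasisSeq e N) (d : ℕ) (x : H) :
    ‖coordL e d x‖ ≤ ‖x‖ := by
  have h1 : ‖coordL e d x‖ ^ 2 ≤ ‖x‖ ^ 2 := by
    rw [← real_inner_self_eq_norm_sq, ← ContinuousLinearMap.adjoint_inner_left]
    calc ⟪projL e d x, x⟫ ≤ ‖projL e d x‖ * ‖x‖ := real_inner_le_norm _ _
      _ ≤ ‖x‖ * ‖x‖ := by gcongr; exact he.norm_projL_apply_le d x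
      _ = ‖x‖ ^ 2 := (sq _).symm
  exact (sq_le_sq₀ (norm_nonneg _) (norm_nonneg _)).1 h1

theorem norm_coordL_le (he : IsOrthonormalBasisSeq e N) (d : ℕ) : ‖coordL e d‖ ≤ 1 :=
  ContinuousLinearMap.opNorm_le_bound _ zero_le_one fun x => by
    simpa using he.norm_coordL_apply_le d x

theorem norm_adjoint_coordL_le (he : IsOrthonormalBasisSeq e N) (d : ℕ) :
    ‖(coordL e d).adjoint‖ ≤ 1 := by
  rw [LinearIsometryEquiv.norm_map]
  exact he.norm_coordL_le d

theorem norm_adjoint_coordL_apply_le (he : IsOrthonormalBasisSeq e N) (d : ℕ)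
    (y : EuclideanSpace ℝ (Fin d)) : ‖(coordL e d).adjoint y‖ ≤ ‖y‖ := by
  simpa using (coordL e d).adjoint.le_of_opNorm_le (he.norm_adjoint_coordL_le d) y

/-- On the dense span of the basis the projections are eventually the identity; contractivity
carries the limit to the closure. -/
theorem tendsto_projL (he : IsOrthonormalBasisSeq e N) (x : H) :
    Tendsto (fun d => projL e d x) atTop (𝓝 x) := by
  have hspan : ∀ y ∈ Submodule.span ℝ (Set.range e), ∀ᶠ d in atTop, projL e d y = y := by
    intro y hy
    induction hy using Submodule.span_induction with
    | mem y hy =>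
      obtain ⟨i, rfl⟩ := hy
      filter_upwards [eventually_gt_atTop i] with d hd using he.projL_basis hd
    | zero => exact Eventually.of_forall fun d => map_zero _
    | add y z _ _ h1 h2 =>
      filter_upwards [h1, h2] with d h1 h2
      rw [map_add, h1, h2]
    | smul c y _ h =>
      filter_upwards [h] with d h
      rw [map_smul, h]
  have hx : x ∈ closure (Submodule.span ℝ (Set.range e) : Set H) := by
    rw [← Submodule.topologicalClosure_coe, he.dense_span]; trivial
  rw [Metric.tendsto_nhds]
  intro ε hε
  obtain ⟨y, hy, hxy⟩ := Metric.mem_closure_iff.1 hx (ε / 2) (by positivity)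
  filter_upwards [hspan y hy] with d hd
  have h1 : projL e d x - x = projL e d (x - y) + (y - x) := by
    rw [map_sub, hd]; abel
  rw [dist_eq_norm] at hxy ⊢
  rw [h1]
  have h2 := he.norm_projL_apply_le d (x - y)
  have h3 := norm_add_le (projL e d (x - y)) (y - x)
  rw [norm_sub_rev y x] at h3
  linarith

/-- Strong convergence of the projections, jointly with the argument. -/
theorem tendsto_projL_comp (he : IsOrthonormalBasisSeq e N) {ι : Type*} {l : Filter ι}
    {d : ι → ℕ} {u : ι → H} {x : H} (hd : Tendsto d l atTop) (hu : Tendsto u l (𝓝 x)) :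
    Tendsto (fun i => projL e (d i) (u i)) l (𝓝 x) := by
  have h1 : Tendsto (fun i => projL e (d i) x) l (𝓝 x) := (he.tendsto_projL x).comp hd
  have h2 : Tendsto (fun i => projL e (d i) (u i - x)) l (𝓝 0) := by
    refine squeeze_zero_norm (fun i => he.norm_projL_apply_le _ _) ?_
    simpa using (hu.sub_const x).norm
  simpa using h2.add h1

theorem projL_eq_of_le (he : IsOrthonormalBasisSeq e N) {n d : ℕ} (hn : N ≤ n) (hd : n ≤ d) :
    projL e d = projL e n := by
  ext x
  rw [projL_apply, projL_apply, projMap, projMap]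
  refine (Finset.sum_subset (Finset.range_mono hd) fun i _ hi => ?_).symm
  rw [he.eq_zero i (hn.trans (by exact_mod_cast not_lt.1 (mt Finset.mem_range.2 hi))), smul_zero]

/-- Ensures that `d = dim H` is an admissible index `d ≥ 1` in finite dimension. -/
theorem ne_zero [Nontrivial H] (he : IsOrthonormalBasisSeq e N) : N ≠ 0 := by
  rintro rfl
  have h1 : Submodule.span ℝ (Set.range e) = ⊥ := by
    rw [Submodule.span_eq_bot]
    rintro _ ⟨i, rfl⟩
    exact he.eq_zero i zero_le
  have h2 := he.dense_span
  rw [h1, Submodule.closed_of_finiteDimensional _ |>.submodule_topologicalClosure_eq] at h2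
  exact bot_ne_top h2

/-- What holds for the projections of large index holds for one of index at most `dim H`. -/
theorem exists_le_of_eventually [Nontrivial H] (he : IsOrthonormalBasisSeq e N)
    {Q : (H →L[ℝ] H) → Prop} (hQ : ∀ᶠ d in atTop, Q (projL e d)) :
    ∃ d : ℕ, 1 ≤ d ∧ (d : ℕ∞) ≤ N ∧ Q (projL e d) := by
  -- `Q` concerns the operator and not its index: in dimension `n` all `P_d` with `d ≥ n` equal
  -- `P_n`, so a large index can be lowered to `n`.
  cases hN : N using ENat.recTopCoe with
  | top =>
    obtain ⟨d, h1, h2⟩ := (hQ.and (eventually_ge_atTop 1)).exists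
    exact ⟨d, h2, le_top, h1⟩
  | coe n =>
    obtain ⟨d, h1, h2⟩ := (hQ.and (eventually_ge_atTop n)).exists
    refine ⟨n, ?_, le_rfl, ?_⟩
    · have := he.ne_zero
      rw [hN] at this
      exact Nat.one_le_iff_ne_zero.2 (by exact_mod_cast this)
    · rwa [← he.projL_eq_of_le hN.le h2]

end IsOrthonormalBasisSeq

end Projection

end

/-! ### Convergence of the Galerkin truncations -/

noncomputable section

set_option linter.unusedSectionVars false

/-- Joint convergence at each point of a compact set is locally uniform, hence uniform on the set:
by compactness `l ×ˢ 𝓝ˢ K` is the supremum of the filters `l ×ˢ 𝓝 x`. -/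
theorem IsCompact.eventually_forall_abs_lt {ι X : Type*} [TopologicalSpace X] {l : Filter ι}
    {K : Set X} (hK : IsCompact K) {g : ι → X → ℝ}
    (hg : ∀ x ∈ K, Tendsto (fun p : ι × X => g p.1 p.2) (l ×ˢ 𝓝 x) (𝓝 0)) {η : ℝ} (hη : 0 < η) :
    ∀ᶠ i in l, ∀ x ∈ K, |g i x| < η := by
  have h1 : ∀ᶠ p : ι × X in l ×ˢ 𝓝ˢ K, |g p.1 p.2| < η := by
    rw [hK.prod_nhdsSet_eq_biSup]
    simp only [eventually_iSup]
    intro x hx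
    filter_upwards [(hg x hx).eventually (Metric.ball_mem_nhds 0 hη)] with p hp
    simpa using hp
  exact h1.curry.mono fun _ h => h.self_of_nhdsSet

variable {H : Type*} [NormedAddCommGroup H] [InnerProductSpace ℝ H] [CompleteSpace H]
  {e : ℕ → H} {N : ℕ∞} {v : H → ℝ} {L : H →ₗ.[ℝ] H} {F : H → ℝ → H → SymOp H → ℝ}

/-- The Galerkin truncation `v ∘ P_d`. -/
def trunc (e : ℕ → H) (v : H → ℝ) (d : ℕ) (x : H) : ℝ := v (projL e d x)

theorem contDiff_trunc (hv : ContDiff ℝ 2 v) (d : ℕ) : ContDiff ℝ 2 (trunc e v d) :=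
  hv.comp (projL e d).contDiff

theorem gradient_trunc (hv : ContDiff ℝ 2 v) (d : ℕ) (x : H) :
    ∇ (trunc e v d) x = projL e d (∇ v (projL e d x)) := by
  have h := gradient_comp_clm (hv.differentiable two_ne_zero) (projL e d) x
  rwa [adjoint_projL] at h

theorem hessOp_trunc (hv : ContDiff ℝ 2 v) (d : ℕ) (x : H) :
    hessOp (trunc e v d) x = projL e d ∘L hessOp v (projL e d x) ∘L projL e d := by
  have h := hessOp_comp_clm hv (projL e d) x
  rwa [adjoint_projL] at h

theorem tendsto_clm_apply {ι : Type*} {l : Filter ι} {A : ι → H →L[ℝ] H} {A₀ : H →L[ℝ] H}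
    (hA : Tendsto A l (𝓝 A₀)) {h : ι → H} {h₀ : H} (hh : Tendsto h l (𝓝 h₀)) :
    Tendsto (fun i => A i (h i)) l (𝓝 (A₀ h₀)) :=
  ((isBoundedBilinearMap_apply (𝕜 := ℝ) (E := H) (F := H)).continuous.tendsto (A₀, h₀)).comp
    (hA.prodMk_nhds hh)

/-! ### Joint limits in the index and the base point (a moving `u` serves compact sets, a constant
`u` dominated convergence) -/

section Convergence

variable {ι : Type*} {l : Filter ι} {d : ι → ℕ} {u : ι → H} {x : H}

theorem tendsto_trunc (he : IsOrthonormalBasisSeq e N) (hv : ContDiff ℝ 2 v)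
    (hd : Tendsto d l atTop) (hu : Tendsto u l (𝓝 x)) :
    Tendsto (fun i => trunc e v (d i) (u i)) l (𝓝 (v x)) :=
  (hv.continuous.tendsto x).comp (he.tendsto_projL_comp hd hu)

theorem tendsto_gradient_trunc (he : IsOrthonormalBasisSeq e N) (hv : ContDiff ℝ 2 v)
    (hd : Tendsto d l atTop) (hu : Tendsto u l (𝓝 x)) :
    Tendsto (fun i => ∇ (trunc e v (d i)) (u i)) l (𝓝 (∇ v x)) := by
  simp only [gradient_trunc hv]
  exact he.tendsto_projL_comp hd
    (((continuous_gradient hv).tendsto x).comp (he.tendsto_projL_comp hd hu))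

/-- The outer projections converge only strongly, so the Hessian is tested on vectors. Letting the
vector move as well is what later gives uniformity over compact sets of directions. -/
theorem tendsto_hessOp_trunc (he : IsOrthonormalBasisSeq e N) (hv : ContDiff ℝ 2 v)
    (hd : Tendsto d l atTop) (hu : Tendsto u l (𝓝 x)) {h : ι → H} {h₀ : H}
    (hh : Tendsto h l (𝓝 h₀)) :
    Tendsto (fun i => hessOp (trunc e v (d i)) (u i) (h i)) l (𝓝 (hessOp v x h₀)) := by
  simp only [hessOp_trunc hv, ContinuousLinearMap.comp_apply]
  exact he.tendsto_projL_comp hd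
    (tendsto_clm_apply
      (((continuous_hessOp hv).tendsto x).comp (he.tendsto_projL_comp hd hu))
      (he.tendsto_projL_comp hd hh))

theorem tendsto_nonlinearity_trunc [l.IsCountablyGenerated] (he : IsOrthonormalBasisSeq e N)
    (hv : ContDiff ℝ 2 v) (hF : SeqContinuousCompactOpen F)
    (hd : Tendsto d l atTop) (hu : Tendsto u l (𝓝 x)) :
    Tendsto (fun i => F (u i) (trunc e v (d i) (u i)) (∇ (trunc e v (d i)) (u i))
      (hess (trunc e v (d i)) (u i))) l (𝓝 (F x (v x) (∇ v x) (hess v x))) := by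
  -- The hypothesis on `F` is sequential, hence the passage to sequences, which needs a countably
  -- generated filter.
  refine tendsto_of_seq_tendsto fun s hs => ?_
  have hd' := hd.comp hs
  have hu' := hu.comp hs
  refine hF _ _ _ _ _ _ _ _ hu' (tendsto_trunc he hv hd' hu') (tendsto_gradient_trunc he hv hd' hu')
    fun K hK => ?_
  rw [Metric.tendstoUniformlyOn_iff]
  intro η hη
  have h1 := hK.eventually_forall_abs_lt (l := atTop)
    (g := fun n h => ‖hessOp v x h - hessOp (trunc e v (d (s n))) (u (s n)) h‖) (fun h _ => ?_) hη
  · filter_upwards [h1] with n hn h hh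
    rw [coe_hess hv, coe_hess (contDiff_trunc hv _), dist_eq_norm]
    simpa using hn h hh
  · have h2 : Tendsto (fun p : ℕ × H => hessOp (trunc e v (d (s p.1))) (u (s p.1)) p.2)
        (atTop ×ˢ 𝓝 h) (𝓝 (hessOp v x h)) :=
      tendsto_hessOp_trunc he hv (hd'.comp tendsto_fst) (hu'.comp tendsto_fst) tendsto_snd
    have h3 : Tendsto (fun p : ℕ × H => hessOp v x p.2) (atTop ×ˢ 𝓝 h) (𝓝 (hessOp v x h)) :=
      ((hessOp v x).continuous.tendsto h).comp tendsto_snd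
    simpa using (h3.sub h2).norm

end Convergence

theorem continuous_nonlinearity {k : ℝ} (hF : LipschitzWithWeight F k) {w : H → ℝ}
    (hw : ContDiff ℝ 2 w) : Continuous fun x => F x (w x) (∇ w x) (hess w x) :=
  hF.1.comp (continuous_id.prodMk (hw.continuous.prodMk
    ((continuous_gradient hw).prodMk (continuous_hess hw))))

/-! ### The unbounded operator on spans of basis vectors -/

section UnboundedOperator

theorem opApply_of_mem {y : H} (hy : y ∈ L.domain) : opApply L y = L ⟨y, hy⟩ := by
  rw [opApply, dif_pos hy]

theorem opApply_sub {y z : H} (hy : y ∈ L.domain) (hz : z ∈ L.domain) :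
    opApply L (y - z) = opApply L y - opApply L z := by
  rw [opApply_of_mem hy, opApply_of_mem hz, opApply_of_mem (L.domain.sub_mem hy hz),
    ← LinearPMap.map_sub]
  rfl

theorem adjoint_coordL_mem (heL : ∀ i, e i ∈ L.domain) (d : ℕ) (y : EuclideanSpace ℝ (Fin d)) :
    (coordL e d).adjoint y ∈ L.domain := by
  rw [adjoint_coordL_apply]
  exact L.domain.sum_mem fun i _ => L.domain.smul_mem _ (heL i)

/-- On the span of finitely many basis vectors `L` is a bounded operator. -/
theorem exists_clm_opApply (heL : ∀ i, e i ∈ L.domain) (d : ℕ) :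
    ∃ M : EuclideanSpace ℝ (Fin d) →L[ℝ] H, ∀ y, opApply L ((coordL e d).adjoint y) = M y := by
  refine ⟨LinearMap.toContinuousLinearMap (L.toFun ∘ₗ
    ((coordL e d).adjoint : EuclideanSpace ℝ (Fin d) →ₗ[ℝ] H).codRestrict L.domain
      (adjoint_coordL_mem heL d)), fun y => ?_⟩
  rw [opApply_of_mem (adjoint_coordL_mem heL d y)]
  rfl

end UnboundedOperator

/-! ### The finite-dimensional gap between truncation and approximant -/

section Galerkin

variable {d : ℕ} {f : EuclideanSpace ℝ (Fin d) → ℝ}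

/-- The finite-dimensional function `y ↦ v (∑ y_i e_i) - f y`. -/
def galerkinGap (e : ℕ → H) (v : H → ℝ) {d : ℕ} (f : EuclideanSpace ℝ (Fin d) → ℝ)
    (y : EuclideanSpace ℝ (Fin d)) : ℝ := v ((coordL e d).adjoint y) - f y

theorem contDiff_restrict (hv : ContDiff ℝ 2 v) (d : ℕ) :
    ContDiff ℝ 2 fun y => v ((coordL e d).adjoint y) :=
  hv.comp (coordL e d).adjoint.contDiff

theorem contDiff_galerkinGap (hv : ContDiff ℝ 2 v) (hf : ContDiff ℝ 2 f) :
    ContDiff ℝ 2 (galerkinGap e v f) :=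
  (contDiff_restrict hv d).sub hf

theorem hgno_eq (e : ℕ → H) (f : EuclideanSpace ℝ (Fin d) → ℝ) :
    hgno e f = fun x => f (coordL e d x) :=
  funext fun x => by rw [hgno, coordL_apply]

theorem contDiff_hgno (hf : ContDiff ℝ 2 f) : ContDiff ℝ 2 (hgno e f) := by
  rw [hgno_eq]
  exact hf.comp (coordL e d).contDiff

theorem gradient_hgno (hf : ContDiff ℝ 2 f) (x : H) :
    ∇ (hgno e f) x = (coordL e d).adjoint (∇ f (coordL e d x)) := by
  rw [hgno_eq]
  exact gradient_comp_clm (hf.differentiable two_ne_zero) _ x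

/-- Definitional once `P_d` is factored as `E_d* E_d`: the truncation is itself a function of the
first `d` coordinates. -/
theorem trunc_sub_hgno (x : H) :
    trunc e v d x - hgno e f x = galerkinGap e v f (coordL e d x) := by
  rw [hgno_eq]; rfl

theorem trunc_sub_hgno_fun :
    (fun x => trunc e v d x - hgno e f x) = fun x => galerkinGap e v f (coordL e d x) :=
  funext trunc_sub_hgno

theorem gradient_trunc_sub_hgno (hv : ContDiff ℝ 2 v) (hf : ContDiff ℝ 2 f) (x : H) :
    ∇ (trunc e v d) x - ∇ (hgno e f) x =
      (coordL e d).adjoint (∇ (galerkinGap e v f) (coordL e d x)) := by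
  rw [← gradient_sub_fun (contDiff_trunc hv d) (contDiff_hgno hf), trunc_sub_hgno_fun]
  exact gradient_comp_clm ((contDiff_galerkinGap hv hf).differentiable two_ne_zero) _ x

theorem hessOp_trunc_sub_hgno (hv : ContDiff ℝ 2 v) (hf : ContDiff ℝ 2 f) (x : H) :
    hessOp (trunc e v d) x - hessOp (hgno e f) x = (coordL e d).adjoint ∘L
      hessOp (galerkinGap e v f) (coordL e d x) ∘L coordL e d := by
  rw [← hessOp_sub_fun (contDiff_trunc hv d) (contDiff_hgno hf), trunc_sub_hgno_fun]
  exact hessOp_comp_clm (contDiff_galerkinGap hv hf) _ x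

theorem norm_gradient_trunc_sub_hgno_le (he : IsOrthonormalBasisSeq e N) (hv : ContDiff ℝ 2 v)
    (hf : ContDiff ℝ 2 f) (x : H) :
    ‖∇ (trunc e v d) x - ∇ (hgno e f) x‖ ≤ ‖∇ (galerkinGap e v f) (coordL e d x)‖ := by
  rw [gradient_trunc_sub_hgno hv hf]
  exact he.norm_adjoint_coordL_apply_le d _

theorem norm_hessOp_trunc_sub_hgno_le (he : IsOrthonormalBasisSeq e N) (hv : ContDiff ℝ 2 v)
    (hf : ContDiff ℝ 2 f) (x : H) :
    ‖hessOp (trunc e v d) x - hessOp (hgno e f) x‖ ≤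
      ‖hessOp (galerkinGap e v f) (coordL e d x)‖ := by
  rw [hessOp_trunc_sub_hgno hv hf]
  refine ContinuousLinearMap.opNorm_le_bound _ (norm_nonneg _) fun h => ?_
  simp only [ContinuousLinearMap.comp_apply]
  refine (he.norm_adjoint_coordL_apply_le d _).trans ((ContinuousLinearMap.le_opNorm _ _).trans ?_)
  gcongr
  exact he.norm_coordL_apply_le d h

theorem gradient_hgno_mem (heL : ∀ i, e i ∈ L.domain) (hf : ContDiff ℝ 2 f) (x : H) :
    ∇ (hgno e f) x ∈ L.domain := by
  rw [gradient_hgno hf]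
  exact adjoint_coordL_mem heL d _

theorem gradient_trunc_mem (heL : ∀ i, e i ∈ L.domain) (hv : ContDiff ℝ 2 v) (x : H) :
    ∇ (trunc e v d) x ∈ L.domain := by
  rw [gradient_trunc hv]
  exact adjoint_coordL_mem heL d _

theorem consistencyError_eq (hv : ContDiff ℝ 2 v) (d : ℕ) (x : H) :
    consistencyError L e v d x = ⟪opApply L (∇ v x - ∇ (trunc e v d) x), x⟫ := by
  rw [consistencyError, gradient_trunc hv, projL_apply, projL_apply]

/-- Splitting of the drift error into the consistency error and a finite-dimensional one. -/
theorem inner_opApply_sub_hgno (hv : ContDiff ℝ 2 v) (hvL : ∀ x, ∇ v x ∈ L.domain)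
    (heL : ∀ i, e i ∈ L.domain) (hf : ContDiff ℝ 2 f)
    {M : EuclideanSpace ℝ (Fin d) →L[ℝ] H} (hM : ∀ y, opApply L ((coordL e d).adjoint y) = M y)
    (x : H) :
    ⟪opApply L (∇ v x - ∇ (hgno e f) x), x⟫ = consistencyError L e v d x +
      ⟪M (∇ (galerkinGap e v f) (coordL e d x)), x⟫ := by
  rw [consistencyError_eq hv, ← hM, ← gradient_trunc_sub_hgno hv hf, ← inner_add_left]
  have h1 := hvL x
  have h2 := gradient_trunc_mem (d := d) (e := e) heL hv x
  have h3 := gradient_hgno_mem (e := e) heL hf x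
  rw [opApply_sub h1 h3, opApply_sub h1 h2, opApply_sub h2 h3]
  abel_nf

/-- The residual of a function whose gradient lies in the domain, relative to a solution. -/
theorem pdeResidual_hgno (hv : IsClassicalSolution L F v) (heL : ∀ i, e i ∈ L.domain)
    (hf : ContDiff ℝ 2 f) (x : H) :
    pdeResidual L F (hgno e f) x =
      (F x (trunc e v d x) (∇ (trunc e v d) x) (hess (trunc e v d) x)
          - F x (v x) (∇ v x) (hess v x))
        - (F x (trunc e v d x) (∇ (trunc e v d) x) (hess (trunc e v d) x)
          - F x (hgno e f x) (∇ (hgno e f) x) (hess (hgno e f) x))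
        - ⟪opApply L (∇ v x - ∇ (hgno e f) x), x⟫ := by
  -- The equation for `v` replaces `⟨L Dv, x⟩` by `-F(x, v, Dv, D²v)`; the truncated nonlinearity is
  -- added and subtracted.
  have h0 := hv.equation x
  rw [opApply_sub (hv.gradient_mem x) (gradient_hgno_mem heL hf x), inner_sub_left]
  rw [pdeResidual] at h0 ⊢
  linarith

theorem abs_nonlinearity_trunc_sub_hgno_le {C k : ℝ} (hC : 0 ≤ C)
    (hF : ∀ (x : H) (v r : ℝ) (p q : H) (Z Y : SymOp H),
      |F x v p Z - F x r q Y| ≤ C * (|v - r| + ‖p - q‖ + ‖Z - Y‖) * (1 + ‖x‖ ^ k))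
    (he : IsOrthonormalBasisSeq e N) (hv : ContDiff ℝ 2 v) (hf : ContDiff ℝ 2 f) (x : H) :
    |F x (trunc e v d x) (∇ (trunc e v d) x) (hess (trunc e v d) x)
        - F x (hgno e f x) (∇ (hgno e f) x) (hess (hgno e f) x)| ≤
      C * (|galerkinGap e v f (coordL e d x)| + ‖∇ (galerkinGap e v f) (coordL e d x)‖
        + ‖hessOp (galerkinGap e v f) (coordL e d x)‖) * (1 + ‖x‖ ^ k) := by
  refine (hF _ _ _ _ _ _ _).trans ?_
  rw [norm_hess_sub (contDiff_trunc hv d) (contDiff_hgno hf), trunc_sub_hgno]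
  gcongr
  · exact norm_gradient_trunc_sub_hgno_le he hv hf x
  · exact norm_hessOp_trunc_sub_hgno_le he hv hf x

end Galerkin

end

/-! ### Part (i): uniform approximation on compact sets -/

noncomputable section

variable {H : Type*} [NormedAddCommGroup H] [InnerProductSpace ℝ H] [CompleteSpace H]
  {e : ℕ → H} {N : ℕ∞} {v : H → ℝ} {L : H →ₗ.[ℝ] H} {F : H → ℝ → H → SymOp H → ℝ}

/-- The truncations of a solution approximate it uniformly on compact sets. -/
theorem eventually_trunc_close (he : IsOrthonormalBasisSeq e N) (hv : ContDiff ℝ 2 v) {k : ℝ}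
    (hFlip : LipschitzWithWeight F k) (hFseq : SeqContinuousCompactOpen F)
    {K K' : Set H} (hK : IsCompact K) (hK' : IsCompact K') {η : ℝ} (hη : 0 < η) :
    ∀ᶠ d in atTop, (∀ x ∈ K, |v x - trunc e v d x| < η) ∧
      (∀ x ∈ K, ‖∇ v x - ∇ (trunc e v d) x‖ < η) ∧
      (∀ x ∈ K, ∀ h ∈ K', ‖(hessOp v x - hessOp (trunc e v d) x) h‖ < η) ∧
      ∀ x ∈ K, |F x (trunc e v d x) (∇ (trunc e v d) x) (hess (trunc e v d) x)
          - F x (v x) (∇ v x) (hess v x)| < η := by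
  refine ((hK.eventually_forall_abs_lt (g := fun d x => v x - trunc e v d x) ?_ hη).and
    (((hK.eventually_forall_abs_lt (g := fun d x => ‖∇ v x - ∇ (trunc e v d) x‖) ?_ hη).and
    (((hK.prod hK').eventually_forall_abs_lt
      (g := fun d z => ‖(hessOp v z.1 - hessOp (trunc e v d) z.1) z.2‖) ?_ hη).and
    (hK.eventually_forall_abs_lt (g := fun d x =>
      F x (trunc e v d x) (∇ (trunc e v d) x) (hess (trunc e v d) x)
          - F x (v x) (∇ v x) (hess v x)) ?_ hη))))).mono ?_
  · intro x _
    simpa using ((hv.continuous.tendsto x).comp tendsto_snd).sub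
      (tendsto_trunc he hv tendsto_fst tendsto_snd)
  · intro x _
    simpa using ((((continuous_gradient hv).tendsto x).comp tendsto_snd).sub
      (tendsto_gradient_trunc he hv tendsto_fst tendsto_snd)).norm
  · intro z _
    have h2 : Tendsto (fun p : ℕ × H × H => p.2) (atTop ×ˢ 𝓝 z) (𝓝 z) := tendsto_snd
    have h3 : Tendsto (fun p : ℕ × H × H => p.2.1) (atTop ×ˢ 𝓝 z) (𝓝 z.1) :=
      (continuous_fst.tendsto z).comp h2
    have h4 : Tendsto (fun p : ℕ × H × H => p.2.2) (atTop ×ˢ 𝓝 z) (𝓝 z.2) :=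
      (continuous_snd.tendsto z).comp h2
    simpa using ((tendsto_clm_apply (((continuous_hessOp hv).tendsto z.1).comp h3) h4).sub
      (tendsto_hessOp_trunc he hv tendsto_fst h3 h4)).norm
  · intro x _
    simpa using (tendsto_nonlinearity_trunc he hv hFseq tendsto_fst tendsto_snd).sub
      (((continuous_nonlinearity hFlip hv).tendsto x).comp tendsto_snd)
  · rintro d ⟨h1, h2, h3, h4⟩
    refine ⟨h1, fun x hx => ?_, fun x hx h hh => ?_, h4⟩
    · simpa using h2 x hx
    · simpa using h3 (x, h) ⟨hx, hh⟩

theorem exists_hgno_uniform_approx [Nontrivial H] {k : ℝ} (hk : 0 ≤ k)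
    (hFlip : LipschitzWithWeight F k) (hFseq : SeqContinuousCompactOpen F)
    (he : IsOrthonormalBasisSeq e N) (heL : ∀ i, e i ∈ L.domain)
    {Θ : ℕ → Type*} {net : (d : ℕ) → Θ d → EuclideanSpace ℝ (Fin d) → ℝ}
    (hnet : ∀ d : ℕ, 1 ≤ d → ∀ θ : Θ d, ContDiff ℝ 2 (net d θ))
    (hv : IsClassicalSolution L F v) (huniv : UniversalOnCompacts net)
    {K K' : Set H} (hK : IsCompact K) (hK' : IsCompact K')
    (hcons : ∀ η : ℝ, 0 < η → ∀ᶠ d : ℕ in atTop, ∀ x ∈ K, |consistencyError L e v d x| < η)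
    {ε : ℝ} (hε : 0 < ε) :
    ∃ d : ℕ, 1 ≤ d ∧ (d : ℕ∞) ≤ N ∧ ∃ θ : Θ d,
      ContDiff ℝ 2 (hgno e (net d θ)) ∧
      (∀ x, ∇ (hgno e (net d θ)) x ∈ L.domain) ∧
      (∀ x ∈ K, |v x - hgno e (net d θ) x| < ε) ∧
      (∀ x ∈ K, ‖∇ v x - ∇ (hgno e (net d θ)) x‖ < ε) ∧
      (∀ x ∈ K, ∀ h ∈ K', ‖(hessOp v x - hessOp (hgno e (net d θ)) x) h‖ < ε) ∧
      (∀ x ∈ K, |⟪opApply L (∇ v x - ∇ (hgno e (net d θ)) x), x⟫| < ε) ∧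
      (∀ x ∈ K, |pdeResidual L F (hgno e (net d θ)) x| < ε) := by
  have hv2 := hv.contDiff
  have hη : 0 < ε / 4 := by positivity
  have hcons' := hcons _ hη
  -- In this form the consistency error depends on `d` only through `P_d`, as
  -- `exists_le_of_eventually` requires.
  simp only [consistencyError_eq hv2] at hcons'
  obtain ⟨d, hd1, hdN, ⟨h1, h2, h3, h4⟩, h5⟩ := he.exists_le_of_eventually
    (Q := fun T => ((∀ x ∈ K, |v x - v (T x)| < ε / 4) ∧
      (∀ x ∈ K, ‖∇ v x - ∇ (fun z => v (T z)) x‖ < ε / 4) ∧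
      (∀ x ∈ K, ∀ h ∈ K', ‖(hessOp v x - hessOp (fun z => v (T z)) x) h‖ < ε / 4) ∧
      ∀ x ∈ K, |F x (v (T x)) (∇ (fun z => v (T z)) x) (hess (fun z => v (T z)) x)
          - F x (v x) (∇ v x) (hess v x)| < ε / 4) ∧
      ∀ x ∈ K, |⟪opApply L (∇ v x - ∇ (fun z => v (T z)) x), x⟫| < ε / 4)
    ((eventually_trunc_close he hv2 hFlip hFseq hK hK' hη).and hcons')
  change ∀ x ∈ K, |v x - trunc e v d x| < ε / 4 at h1
  change ∀ x ∈ K, ‖∇ v x - ∇ (trunc e v d) x‖ < ε / 4 at h2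
  change ∀ x ∈ K, ∀ h ∈ K', ‖(hessOp v x - hessOp (trunc e v d) x) h‖ < ε / 4 at h3
  change ∀ x ∈ K, |F x (trunc e v d x) (∇ (trunc e v d) x) (hess (trunc e v d) x)
          - F x (v x) (∇ v x) (hess v x)| < ε / 4 at h4
  change ∀ x ∈ K, |⟪opApply L (∇ v x - ∇ (trunc e v d) x), x⟫| < ε / 4 at h5
  simp only [← consistencyError_eq hv2] at h5
  obtain ⟨C, hC, hF⟩ := hFlip.2
  obtain ⟨M, hM⟩ := exists_clm_opApply heL d
  obtain ⟨R, hR⟩ := hK.exists_bound_of_continuousOn (continuous_id (X := H)).continuousOn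
  obtain ⟨R', hR'⟩ := hK'.exists_bound_of_continuousOn (continuous_id (X := H)).continuousOn
  simp only [id] at hR hR'
  -- Absolute values are taken because the bounds `R` and `R'` may be negative when `K` or `K'` is
  -- empty.
  set W := 1 + |R| ^ k with hW
  have hWpos : 0 < W := by positivity
  have hD : 0 < 1 + |R'| + ‖M‖ * |R| + 3 * C * W := by positivity
  -- One tolerance for all five estimates: the summands serve value and gradient, the Hessian on
  -- `K'`, the drift, and the Lipschitz bound for `F` (three gap terms, weight at most `W`). Each
  -- contribution is then at most `ε / 4`.
  set δ := ε / 4 / (1 + |R'| + ‖M‖ * |R| + 3 * C * W) with hδ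
  have hδpos : 0 < δ := by positivity
  have hδeq : δ * (1 + |R'| + ‖M‖ * |R| + 3 * C * W) = ε / 4 := by
    rw [hδ]; field_simp
  have hb1 : 0 ≤ δ * |R'| := by positivity
  have hb2 : 0 ≤ δ * (‖M‖ * |R|) := by positivity
  have hb3 : 0 ≤ δ * (3 * C * W) := by positivity
  obtain ⟨θ, hθ⟩ := huniv d hd1 _ (contDiff_restrict (e := e) hv2 d) (coordL e d '' K)
    (hK.image (coordL e d).continuous) δ hδpos
  have hf := hnet d hd1 θ
  have hg : ∀ x ∈ K, |galerkinGap e v (net d θ) (coordL e d x)| < δ ∧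
      ‖∇ (galerkinGap e v (net d θ)) (coordL e d x)‖ < δ ∧
      ‖hessOp (galerkinGap e v (net d θ)) (coordL e d x)‖ < δ :=
    fun x hx => hθ _ (Set.mem_image_of_mem _ hx)
  have hdrift : ∀ x ∈ K, |⟪opApply L (∇ v x - ∇ (hgno e (net d θ)) x), x⟫| < ε / 2 := by
    intro x hx
    rw [inner_opApply_sub_hgno hv2 hv.gradient_mem heL hf hM]
    have h6 : |⟪M (∇ (galerkinGap e v (net d θ)) (coordL e d x)), x⟫| ≤ δ * (‖M‖ * |R|) := by
      calc _ ≤ ‖M (∇ (galerkinGap e v (net d θ)) (coordL e d x))‖ * ‖x‖ := abs_real_inner_le_norm _ _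
        _ ≤ (‖M‖ * δ) * |R| := by
          gcongr
          · exact (M.le_opNorm _).trans (by gcongr; exact (hg x hx).2.1.le)
          · exact (hR x hx).trans (le_abs_self R)
        _ = _ := by ring
    have h7 := abs_add_le (consistencyError L e v d x)
      ⟪M (∇ (galerkinGap e v (net d θ)) (coordL e d x)), x⟫
    have h8 := h5 x hx
    linarith
  refine ⟨d, hd1, hdN, θ, contDiff_hgno hf, gradient_hgno_mem heL hf, fun x hx => ?_,
    fun x hx => ?_, fun x hx h hh => ?_, fun x hx => (hdrift x hx).trans (by linarith),
    fun x hx => ?_⟩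
  · have h6 := abs_add_le (v x - trunc e v d x) (trunc e v d x - hgno e (net d θ) x)
    rw [sub_add_sub_cancel, trunc_sub_hgno] at h6
    linarith [h1 x hx, (hg x hx).1]
  · have h6 := norm_add_le (∇ v x - ∇ (trunc e v d) x) (∇ (trunc e v d) x - ∇ (hgno e (net d θ)) x)
    rw [sub_add_sub_cancel] at h6
    linarith [h2 x hx, (hg x hx).2.1, norm_gradient_trunc_sub_hgno_le he hv2 hf x]
  · have h6 := norm_add_le ((hessOp v x - hessOp (trunc e v d) x) h)
      ((hessOp (trunc e v d) x - hessOp (hgno e (net d θ)) x) h)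
    rw [← _root_.add_apply, sub_add_sub_cancel] at h6
    have h7 : ‖(hessOp (trunc e v d) x - hessOp (hgno e (net d θ)) x) h‖ ≤ δ * |R'| := by
      refine (ContinuousLinearMap.le_opNorm _ _).trans ?_
      gcongr
      · exact (norm_hessOp_trunc_sub_hgno_le he hv2 hf x).trans (hg x hx).2.2.le
      · exact (hR' h hh).trans (le_abs_self R')
    linarith [h3 x hx h hh]
  · rw [pdeResidual_hgno hv heL hf]
    have h6 := abs_nonlinearity_trunc_sub_hgno_le hC.le hF he hv2 hf x
    have h7 : C * (|galerkinGap e v (net d θ) (coordL e d x)|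
        + ‖∇ (galerkinGap e v (net d θ)) (coordL e d x)‖
        + ‖hessOp (galerkinGap e v (net d θ)) (coordL e d x)‖) * (1 + ‖x‖ ^ k) ≤
        C * (δ + δ + δ) * W := by
      obtain ⟨g1, g2, g3⟩ := hg x hx
      gcongr
      exact add_le_add le_rfl
        (Real.rpow_le_rpow (norm_nonneg _) ((hR x hx).trans (le_abs_self R)) hk)
    have h8 := h4 x hx
    have h9 := hdrift x hx
    -- Budget: `ε / 4` for truncating inside `F`, `ε / 4` for the gap inside `F`, `ε / 2` for the
    -- drift.
    refine (abs_sub _ _).trans_lt ?_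
    refine (add_le_add_left (abs_sub _ _) _).trans_lt ?_
    have h10 : C * (δ + δ + δ) * W = δ * (3 * C * W) := by ring
    linarith

end

/-! ### Integral inequalities and growth bounds -/

noncomputable section

set_option linter.unusedSectionVars false

theorem ENNReal.add_pow_le_two_pow_mul (a b : ℝ≥0∞) (n : ℕ) :
    (a + b) ^ n ≤ 2 ^ n * (a ^ n + b ^ n) := by
  rcases le_total a b with h | h
  · calc (a + b) ^ n ≤ (2 * b) ^ n := by rw [two_mul]; gcongr
      _ = 2 ^ n * b ^ n := mul_pow _ _ _
      _ ≤ _ := by gcongr; exact le_add_self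
  · calc (a + b) ^ n ≤ (2 * a) ^ n := by rw [two_mul]; gcongr
      _ = 2 ^ n * a ^ n := mul_pow _ _ _
      _ ≤ _ := by gcongr; exact le_self_add

section Lintegral

variable {α E : Type*} [MeasurableSpace α] {μ : Measure α} [NormedAddCommGroup E]

/-- Measurability is asked of one summand only, so terms containing `opApply L` can be placed in
`f`. -/
theorem lintegral_enorm_add_pow_le {f g : α → E} (hg : Measurable fun x => ‖g x‖ₑ) (n : ℕ) :
    ∫⁻ x, ‖f x + g x‖ₑ ^ n ∂μ ≤ 2 ^ n * (∫⁻ x, ‖f x‖ₑ ^ n ∂μ + ∫⁻ x, ‖g x‖ₑ ^ n ∂μ) := by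
  rw [← lintegral_add_right _ (hg.pow_const n), ← lintegral_const_mul' _ _ (by simp)]
  refine lintegral_mono fun x => ?_
  refine le_trans ?_ (ENNReal.add_pow_le_two_pow_mul _ _ n)
  gcongr
  exact enorm_add_le _ _

/-- Cauchy-Schwarz for `f ^ 2` and `g ^ 2`; the source of the drop from exponent 4 to exponent 2 for
drift and residual. -/
theorem lintegral_mul_sq_le {f g : α → ℝ≥0∞} (hf : Measurable f) (hg : Measurable g) :
    ∫⁻ x, (f x * g x) ^ 2 ∂μ ≤
      (∫⁻ x, f x ^ 4 ∂μ) ^ (1 / 2 : ℝ) * (∫⁻ x, g x ^ 4 ∂μ) ^ (1 / 2 : ℝ) := by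
  have h := ENNReal.lintegral_mul_le_Lp_mul_Lq μ Real.HolderConjugate.two_two
    (hf.pow_const 2).aemeasurable (hg.pow_const 2).aemeasurable
  have h2 : ∀ a : ℝ≥0∞, (a ^ 2) ^ (2 : ℝ) = a ^ 4 := fun a => by
    rw [ENNReal.rpow_two, ← pow_mul]
  simpa only [Pi.mul_apply, h2, ← mul_pow] using h

theorem tendsto_lintegral_enorm_pow {G : ℕ → α → E} {b : α → ℝ} {p : ℕ} (hp : p ≠ 0)
    (hG : ∀ n, Measurable fun x => ‖G n x‖ₑ) (hb : ∀ n x, ‖G n x‖ ≤ b x)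
    (hfin : ∫⁻ x, ‖b x‖ₑ ^ p ∂μ < ∞) (hlim : ∀ x, Tendsto (fun n => G n x) atTop (𝓝 0)) :
    Tendsto (fun n => ∫⁻ x, ‖G n x‖ₑ ^ p ∂μ) atTop (𝓝 0) := by
  have h := tendsto_lintegral_of_dominated_convergence (μ := μ) (f := fun _ => 0)
    (F := fun n x => ‖G n x‖ₑ ^ p) (fun x => ‖b x‖ₑ ^ p) (fun n => (hG n).pow_const p)
    (fun n => Eventually.of_forall fun x => ?_) hfin.ne (Eventually.of_forall fun x => ?_)
  · simpa using h
  · dsimp only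
    gcongr
    exact enorm_le_iff_norm_le.2 ((hb n x).trans (le_abs_self _))
  · have h1 := ENNReal.Tendsto.pow (n := p) (hlim x).enorm
    simpa [hp] using h1

end Lintegral

variable {H : Type*} [NormedAddCommGroup H] [InnerProductSpace ℝ H] [CompleteSpace H]
  {e : ℕ → H} {N : ℕ∞} {v : H → ℝ} {L : H →ₗ.[ℝ] H} {F : H → ℝ → H → SymOp H → ℝ}

section Growth

variable {k C : ℝ}

theorem weight_projL_le (hk : 0 ≤ k) (he : IsOrthonormalBasisSeq e N) (d : ℕ) (x : H) :
    1 + ‖projL e d x‖ ^ k ≤ 1 + ‖x‖ ^ k := by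
  gcongr
  exact he.norm_projL_apply_le d x

theorem continuous_weight (hk : 0 ≤ k) : Continuous fun x : H => 1 + ‖x‖ ^ k :=
  continuous_const.add (continuous_norm.rpow_const fun _ => Or.inr hk)

variable (hk : 0 ≤ k) (he : IsOrthonormalBasisSeq e N) (hv : ContDiff ℝ 2 v) (hC : 0 < C)
  (hgrowth : ∀ x, |v x| + ‖∇ v x‖ + ‖hessOp v x‖ ≤ C * (1 + ‖x‖ ^ k))

include hk he hC hgrowth

/-- Since `‖P_d x‖ ≤ ‖x‖` and `k ≥ 0`, the weight at `x` dominates for every `d`; this yields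
majorants independent of `d`. -/
theorem growth_projL (d : ℕ) (x : H) :
    |v (projL e d x)| ≤ C * (1 + ‖x‖ ^ k) ∧ ‖∇ v (projL e d x)‖ ≤ C * (1 + ‖x‖ ^ k) ∧
      ‖hessOp v (projL e d x)‖ ≤ C * (1 + ‖x‖ ^ k) := by
  have h1 := (hgrowth (projL e d x)).trans
    (mul_le_mul_of_nonneg_left (weight_projL_le hk he d x) hC.le)
  have h2 := abs_nonneg (v (projL e d x))
  have h3 := norm_nonneg (∇ v (projL e d x))
  have h4 := norm_nonneg (hessOp v (projL e d x))
  exact ⟨by linarith, by linarith, by linarith⟩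

include hv

theorem growth_trunc (d : ℕ) (x : H) :
    |trunc e v d x| ≤ C * (1 + ‖x‖ ^ k) ∧ ‖∇ (trunc e v d) x‖ ≤ C * (1 + ‖x‖ ^ k) ∧
      ‖hessOp (trunc e v d) x‖ ≤ C * (1 + ‖x‖ ^ k) := by
  obtain ⟨h1, h2, h3⟩ := growth_projL hk he hC hgrowth d x
  refine ⟨h1, ?_, ?_⟩
  · rw [gradient_trunc hv]
    exact (he.norm_projL_apply_le d _).trans h2
  · refine le_trans ?_ h3
    rw [hessOp_trunc hv]
    refine ContinuousLinearMap.opNorm_le_bound _ (norm_nonneg _) fun h => ?_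
    simp only [ContinuousLinearMap.comp_apply]
    refine (he.norm_projL_apply_le d _).trans ((ContinuousLinearMap.le_opNorm _ _).trans ?_)
    gcongr
    exact he.norm_projL_apply_le d h

/-- Makes `v ∘ E_d*` an admissible target for Sobolev density under the law of `E_d`. -/
theorem growth_restrict (d : ℕ) (x : H) :
    |v ((coordL e d).adjoint (coordL e d x))| ≤ C * (1 + ‖x‖ ^ k) ∧
      ‖∇ (fun y => v ((coordL e d).adjoint y)) (coordL e d x)‖ ≤ C * (1 + ‖x‖ ^ k) ∧
      ‖hessOp (fun y => v ((coordL e d).adjoint y)) (coordL e d x)‖ ≤ C * (1 + ‖x‖ ^ k) := by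
  obtain ⟨h1, h2, h3⟩ := growth_projL hk he hC hgrowth d x
  refine ⟨h1, ?_, ?_⟩
  · rw [gradient_comp_clm (hv.differentiable two_ne_zero), ContinuousLinearMap.adjoint_adjoint]
    exact (he.norm_coordL_apply_le d _).trans h2
  · refine le_trans ?_ h3
    rw [hessOp_comp_clm hv, ContinuousLinearMap.adjoint_adjoint]
    refine ContinuousLinearMap.opNorm_le_bound _ (norm_nonneg _) fun h => ?_
    simp only [ContinuousLinearMap.comp_apply]
    refine (he.norm_coordL_apply_le d _).trans ((ContinuousLinearMap.le_opNorm _ _).trans ?_)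
    exact mul_le_mul_of_nonneg_left (he.norm_adjoint_coordL_apply_le d h) (norm_nonneg _)

end Growth

section Measure

variable [MeasurableSpace H] [BorelSpace H] {k C : ℝ} {μ : Measure H}

theorem lintegral_weight_lt_top [IsFiniteMeasure μ] (hk : 0 ≤ k) (hμ : Integrable (fun x => ‖x‖ ^ (4 * k)) μ) :
    ∫⁻ x, ‖1 + ‖x‖ ^ k‖ₑ ^ 4 ∂μ < ∞ := by
  have hμ' : ∫⁻ x, ‖‖x‖ ^ k‖ₑ ^ 4 ∂μ < ∞ := by
    refine lt_of_eq_of_lt (lintegral_congr fun x => ?_) hμ.2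
    rw [← enorm_pow, ← Real.rpow_natCast, ← Real.rpow_mul (norm_nonneg _), mul_comm]
    norm_num
  have h1 : Measurable fun x : H => ‖‖x‖ ^ k‖ₑ :=
    (continuous_norm.rpow_const fun _ => Or.inr hk).measurable.enorm
  refine (lintegral_enorm_add_pow_le (f := fun _ => (1 : ℝ)) h1 4).trans_lt ?_
  refine ENNReal.mul_lt_top (by simp) (ENNReal.add_lt_top.2 ⟨?_, hμ'⟩)
  simp

theorem lintegral_const_mul_weight_lt_top (C : ℝ) (hJ : ∫⁻ x, ‖1 + ‖x‖ ^ k‖ₑ ^ 4 ∂μ < ∞) :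
    ∫⁻ x, ‖C * (1 + ‖x‖ ^ k)‖ₑ ^ 4 ∂μ < ∞ := by
  simp only [enorm_mul, mul_pow]
  rw [lintegral_const_mul' _ _ (by simp)]
  exact ENNReal.mul_lt_top (by simp) hJ

theorem sobolevNormPow_map {d : ℕ} (w : ℕ) {g : EuclideanSpace ℝ (Fin d) → ℝ}
    (hg : ContDiff ℝ 2 g) :
    sobolevNormPow w (μ.map (coordL e d)) g = ∫⁻ x, (‖g (coordL e d x)‖ₑ ^ w
      + ‖∇ g (coordL e d x)‖ₑ ^ w + ‖hessOp g (coordL e d x)‖ₑ ^ w) ∂μ := by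
  rw [sobolevNormPow, lintegral_map _ (coordL e d).continuous.measurable]
  exact ((hg.continuous.enorm.measurable.pow_const w).add
    ((continuous_gradient hg).enorm.measurable.pow_const w)).add
    ((continuous_hessOp hg).enorm.measurable.pow_const w)

theorem sobolevNormPow_restrict_lt_top (hk : 0 ≤ k) (he : IsOrthonormalBasisSeq e N)
    (hv : ContDiff ℝ 2 v) (hC : 0 < C)
    (hgrowth : ∀ x, |v x| + ‖∇ v x‖ + ‖hessOp v x‖ ≤ C * (1 + ‖x‖ ^ k))
    (hJ : ∫⁻ x, ‖1 + ‖x‖ ^ k‖ₑ ^ 4 ∂μ < ∞) (d : ℕ) :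
    sobolevNormPow 4 (μ.map (coordL e d)) (fun y => v ((coordL e d).adjoint y)) < ∞ := by
  rw [sobolevNormPow_map 4 (contDiff_restrict hv d)]
  have h1 : ∫⁻ x, 3 * ‖C * (1 + ‖x‖ ^ k)‖ₑ ^ 4 ∂μ < ∞ := by
    rw [lintegral_const_mul' _ _ (by simp)]
    exact ENNReal.mul_lt_top (by simp) (lintegral_const_mul_weight_lt_top C hJ)
  refine lt_of_le_of_lt (lintegral_mono fun x => ?_) h1
  obtain ⟨g1, g2, g3⟩ := growth_restrict hk he hv hC hgrowth d x
  have h3 : ∀ a : ℝ≥0∞, 3 * a = a + a + a := fun a => by ring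
  rw [h3]
  gcongr
  · exact enorm_le_iff_norm_le.2 (g1.trans (le_abs_self _))
  · exact enorm_le_iff_norm_le.2 (g2.trans (le_abs_self _))
  · exact enorm_le_iff_norm_le.2 (g3.trans (le_abs_self _))

end Measure

end

/-! ### Part (ii): truncation errors in the mean -/

noncomputable section

set_option linter.unusedSectionVars false

variable {H : Type*} [NormedAddCommGroup H] [InnerProductSpace ℝ H] [CompleteSpace H]
  {e : ℕ → H} {N : ℕ∞} {v : H → ℝ} {L : H →ₗ.[ℝ] H} {F : H → ℝ → H → SymOp H → ℝ}
  [MeasurableSpace H] [BorelSpace H] {k C : ℝ} {μ μ' : Measure H}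

theorem continuous_hessOp_apply {f : H → ℝ} (hf : ContDiff ℝ 2 f) :
    Continuous fun z : H × H => hessOp f z.1 z.2 :=
  ((continuous_hessOp hf).comp continuous_fst).clm_apply continuous_snd

section TruncationLimits

variable (he : IsOrthonormalBasisSeq e N) (hv : ContDiff ℝ 2 v) (hk : 0 ≤ k) (hC : 0 < C)
  (hgrowth : ∀ x, |v x| + ‖∇ v x‖ + ‖hessOp v x‖ ≤ C * (1 + ‖x‖ ^ k))
  (hJ : ∫⁻ x, ‖1 + ‖x‖ ^ k‖ₑ ^ 4 ∂μ < ∞)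

include hC hgrowth in
theorem growth_self (x : H) : |v x| ≤ C * (1 + ‖x‖ ^ k) ∧ ‖∇ v x‖ ≤ C * (1 + ‖x‖ ^ k) ∧
    ‖hessOp v x‖ ≤ C * (1 + ‖x‖ ^ k) := by
  have h1 := hgrowth x
  have h2 := abs_nonneg (v x)
  have h3 := norm_nonneg (∇ v x)
  have h4 := norm_nonneg (hessOp v x)
  exact ⟨by linarith, by linarith, by linarith⟩

include he hv hk hC hgrowth hJ

theorem tendsto_lintegral_sub_trunc :
    Tendsto (fun d => ∫⁻ x, ‖v x - trunc e v d x‖ₑ ^ 4 ∂μ) atTop (𝓝 0) := by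
  refine tendsto_lintegral_enorm_pow (b := fun x => 2 * C * (1 + ‖x‖ ^ k)) (by norm_num)
    (fun d => (hv.continuous.sub (contDiff_trunc hv d).continuous).enorm.measurable)
    (fun d x => ?_) (lintegral_const_mul_weight_lt_top _ hJ) fun x => ?_
  · have h1 := (growth_trunc hk he hv hC hgrowth d x).1
    have h2 := (growth_self hC hgrowth x).1
    have h3 := norm_sub_le (v x) (trunc e v d x)
    simp only [Real.norm_eq_abs] at h3 ⊢
    linarith
  · simpa using (tendsto_trunc he hv tendsto_id tendsto_const_nhds (x := x)).const_sub (v x)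

theorem tendsto_lintegral_gradient_sub_trunc :
    Tendsto (fun d => ∫⁻ x, ‖∇ v x - ∇ (trunc e v d) x‖ₑ ^ 4 ∂μ) atTop (𝓝 0) := by
  refine tendsto_lintegral_enorm_pow (b := fun x => 2 * C * (1 + ‖x‖ ^ k)) (by norm_num)
    (fun d => ((continuous_gradient hv).sub
      (continuous_gradient (contDiff_trunc hv d))).enorm.measurable)
    (fun d x => ?_) (lintegral_const_mul_weight_lt_top _ hJ) fun x => ?_
  · have h1 := (growth_trunc hk he hv hC hgrowth d x).2.1
    have h2 := (growth_self hC hgrowth x).2.1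
    have h3 := norm_sub_le (∇ v x) (∇ (trunc e v d) x)
    linarith
  · simpa using
      (tendsto_gradient_trunc he hv tendsto_id tendsto_const_nhds (x := x)).const_sub (∇ v x)

theorem tendsto_lintegral_hessOp_sub_trunc [TopologicalSpace.SeparableSpace H] [SFinite μ]
    [SFinite μ'] (hμ' : ∫⁻ h, ‖h‖ₑ ^ 4 ∂μ' < ∞) :
    Tendsto (fun d => ∫⁻ z : H × H, ‖(hessOp v z.1 - hessOp (trunc e v d) z.1) z.2‖ₑ ^ 4
      ∂(μ.prod μ')) atTop (𝓝 0) := by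
  -- Makes the product σ-algebra on `H × H` the Borel one, so continuous functions there are
  -- measurable.
  have : SecondCountableTopology H := UniformSpace.secondCountable_of_separable H
  refine tendsto_lintegral_enorm_pow (b := fun z => 2 * C * (1 + ‖z.1‖ ^ k) * ‖z.2‖) (by norm_num)
    (fun d => ((continuous_hessOp_apply hv).sub
      (continuous_hessOp_apply (contDiff_trunc hv d))).enorm.measurable)
    (fun d z => ?_) ?_ fun z => ?_
  · have h1 := (growth_trunc hk he hv hC hgrowth d z.1).2.2
    have h2 := (growth_self hC hgrowth z.1).2.2
    have h3 := norm_sub_le (hessOp v z.1) (hessOp (trunc e v d) z.1)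
    exact ContinuousLinearMap.le_of_opNorm_le _ (by linarith) _
  · have h1 : ∀ z : H × H, ‖2 * C * (1 + ‖z.1‖ ^ k) * ‖z.2‖‖ₑ ^ 4
        = ‖2 * C * (1 + ‖z.1‖ ^ k)‖ₑ ^ 4 * ‖z.2‖ₑ ^ 4 := fun z => by
      rw [enorm_mul, mul_pow, enorm_norm]
    simp only [h1]
    rw [lintegral_prod_mul (f := fun x : H => ‖2 * C * (1 + ‖x‖ ^ k)‖ₑ ^ 4)
      (g := fun h : H => ‖h‖ₑ ^ 4)
      (((continuous_const.mul (continuous_weight hk)).enorm.measurable.pow_const 4).aemeasurable)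
      ((continuous_enorm.measurable.pow_const 4).aemeasurable)]
    exact ENNReal.mul_lt_top (lintegral_const_mul_weight_lt_top _ hJ) hμ'
  · simpa using (tendsto_hessOp_trunc he hv tendsto_id (tendsto_const_nhds (x := z.1))
      (tendsto_const_nhds (x := z.2))).const_sub (hessOp v z.1 z.2)

theorem tendsto_lintegral_nonlinearity_sub_trunc (hFlip : LipschitzWithWeight F k)
    (hFseq : SeqContinuousCompactOpen F) :
    Tendsto (fun d => ∫⁻ x, ‖F x (trunc e v d x) (∇ (trunc e v d) x) (hess (trunc e v d) x)
      - F x (v x) (∇ v x) (hess v x)‖ₑ ^ 2 ∂μ) atTop (𝓝 0) := by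
  obtain ⟨C', hC', hF⟩ := hFlip.2
  -- Three differences, each at most `2 * C` times the weight, and one more weight from the
  -- Lipschitz bound. Squaring gives the fourth power of the weight, integrable by the moment of
  -- order `4 * k`.
  refine tendsto_lintegral_enorm_pow (b := fun x => C' * (6 * C) * (1 + ‖x‖ ^ k) ^ 2)
    (by norm_num) (fun d => ((continuous_nonlinearity hFlip (contDiff_trunc hv d)).sub
      (continuous_nonlinearity hFlip hv)).enorm.measurable)
    (fun d x => ?_) ?_ fun x => ?_
  · refine (hF _ _ _ _ _ _ _).trans ?_
    rw [norm_hess_sub (contDiff_trunc hv d) hv]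
    obtain ⟨h1, h2, h3⟩ := growth_trunc hk he hv hC hgrowth d x
    obtain ⟨g1, g2, g3⟩ := growth_self hC hgrowth x
    have i1 := abs_sub (trunc e v d x) (v x)
    have i2 := norm_sub_le (∇ (trunc e v d) x) (∇ v x)
    have i3 := norm_sub_le (hessOp (trunc e v d) x) (hessOp v x)
    calc _ ≤ C' * (6 * C * (1 + ‖x‖ ^ k)) * (1 + ‖x‖ ^ k) := by
          gcongr
          linarith
      _ = _ := by ring
  · have h1 : ∀ x : H, ‖C' * (6 * C) * (1 + ‖x‖ ^ k) ^ 2‖ₑ ^ 2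
        = ‖C' * (6 * C)‖ₑ ^ 2 * ‖1 + ‖x‖ ^ k‖ₑ ^ 4 := fun x => by
      rw [enorm_mul, mul_pow, enorm_pow, ← pow_mul]
    simp only [h1]
    rw [lintegral_const_mul' _ _ (ENNReal.pow_ne_top enorm_ne_top)]
    exact ENNReal.mul_lt_top (ENNReal.pow_lt_top enorm_lt_top) hJ
  · simpa using (tendsto_nonlinearity_trunc he hv hFseq tendsto_id
      (tendsto_const_nhds (x := x))).sub_const (F x (v x) (∇ v x) (hess v x))

end TruncationLimits

/-! ### Errors in the mean bounded by the Sobolev norm of the gap -/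

section GalerkinErrors

variable {d : ℕ} {f : EuclideanSpace ℝ (Fin d) → ℝ} {g : EuclideanSpace ℝ (Fin d) → ℝ}

theorem lintegral_le_sobolevNormPow (hg : ContDiff ℝ 2 g) :
    ∫⁻ x, ‖g (coordL e d x)‖ₑ ^ 4 ∂μ ≤ sobolevNormPow 4 (μ.map (coordL e d)) g ∧
    ∫⁻ x, ‖∇ g (coordL e d x)‖ₑ ^ 4 ∂μ ≤ sobolevNormPow 4 (μ.map (coordL e d)) g ∧
    ∫⁻ x, ‖hessOp g (coordL e d x)‖ₑ ^ 4 ∂μ ≤ sobolevNormPow 4 (μ.map (coordL e d)) g := by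
  rw [sobolevNormPow_map 4 hg]
  exact ⟨lintegral_mono fun x => by rw [add_assoc]; exact le_self_add,
    lintegral_mono fun x => le_add_right le_add_self, lintegral_mono fun x => le_add_self⟩

variable (he : IsOrthonormalBasisSeq e N) (hv : ContDiff ℝ 2 v) (hf : ContDiff ℝ 2 f)

include hv hf

theorem lintegral_sub_hgno_le :
    ∫⁻ x, ‖v x - hgno e f x‖ₑ ^ 4 ∂μ ≤ 2 ^ 4 * (∫⁻ x, ‖v x - trunc e v d x‖ₑ ^ 4 ∂μ
      + sobolevNormPow 4 (μ.map (coordL e d)) (galerkinGap e v f)) := by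
  have h := lintegral_enorm_add_pow_le (μ := μ) (f := fun x => v x - trunc e v d x)
    (g := fun x => trunc e v d x - hgno e f x)
    ((contDiff_trunc hv d).continuous.sub (contDiff_hgno hf).continuous).enorm.measurable 4
  simp only [sub_add_sub_cancel] at h
  refine h.trans ?_
  gcongr
  simp only [trunc_sub_hgno]
  exact (lintegral_le_sobolevNormPow (contDiff_galerkinGap hv hf)).1

include he

theorem lintegral_gradient_sub_hgno_le :
    ∫⁻ x, ‖∇ v x - ∇ (hgno e f) x‖ₑ ^ 4 ∂μ ≤
      2 ^ 4 * (∫⁻ x, ‖∇ v x - ∇ (trunc e v d) x‖ₑ ^ 4 ∂μ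
        + sobolevNormPow 4 (μ.map (coordL e d)) (galerkinGap e v f)) := by
  have h := lintegral_enorm_add_pow_le (μ := μ) (f := fun x => ∇ v x - ∇ (trunc e v d) x)
    (g := fun x => ∇ (trunc e v d) x - ∇ (hgno e f) x)
    ((continuous_gradient (contDiff_trunc hv d)).sub
      (continuous_gradient (contDiff_hgno hf))).enorm.measurable 4
  simp only [sub_add_sub_cancel] at h
  refine h.trans ?_
  gcongr
  refine le_trans (lintegral_mono fun x => ?_)
    (lintegral_le_sobolevNormPow (contDiff_galerkinGap hv hf)).2.1
  gcongr
  exact enorm_le_iff_norm_le.2 (norm_gradient_trunc_sub_hgno_le he hv hf x)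

theorem lintegral_hessOp_sub_hgno_le [TopologicalSpace.SeparableSpace H] [SFinite μ]
    [SFinite μ'] :
    ∫⁻ z : H × H, ‖(hessOp v z.1 - hessOp (hgno e f) z.1) z.2‖ₑ ^ 4 ∂(μ.prod μ') ≤
      2 ^ 4 * (∫⁻ z : H × H, ‖(hessOp v z.1 - hessOp (trunc e v d) z.1) z.2‖ₑ ^ 4 ∂(μ.prod μ')
        + sobolevNormPow 4 (μ.map (coordL e d)) (galerkinGap e v f) * ∫⁻ h, ‖h‖ₑ ^ 4 ∂μ') := by
  have : SecondCountableTopology H := UniformSpace.secondCountable_of_separable H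
  have hg := contDiff_galerkinGap (e := e) hv hf
  have h := lintegral_enorm_add_pow_le (μ := μ.prod μ')
    (f := fun z => (hessOp v z.1 - hessOp (trunc e v d) z.1) z.2)
    (g := fun z => (hessOp (trunc e v d) z.1 - hessOp (hgno e f) z.1) z.2)
    ((continuous_hessOp_apply (contDiff_trunc hv d)).sub
      (continuous_hessOp_apply (contDiff_hgno hf))).enorm.measurable 4
  simp only [← _root_.add_apply, sub_add_sub_cancel] at h
  refine h.trans ?_
  gcongr
  calc _ ≤ ∫⁻ z : H × H, ‖hessOp (galerkinGap e v f) (coordL e d z.1)‖ₑ ^ 4 * ‖z.2‖ₑ ^ 4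
        ∂(μ.prod μ') := by
        refine lintegral_mono fun z => ?_
        rw [← mul_pow]
        gcongr
        rw [← enorm_norm (hessOp _ _), ← enorm_norm z.2, ← enorm_mul]
        refine enorm_le_iff_norm_le.2 (le_trans ?_ (le_abs_self _))
        exact ContinuousLinearMap.le_of_opNorm_le _ (norm_hessOp_trunc_sub_hgno_le he hv hf z.1) _
    _ = (∫⁻ x, ‖hessOp (galerkinGap e v f) (coordL e d x)‖ₑ ^ 4 ∂μ) * ∫⁻ h, ‖h‖ₑ ^ 4 ∂μ' :=
        lintegral_prod_mul (f := fun x : H => ‖hessOp (galerkinGap e v f) (coordL e d x)‖ₑ ^ 4)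
          (g := fun h : H => ‖h‖ₑ ^ 4)
          ((((continuous_hessOp hg).comp (coordL e d).continuous).enorm.measurable.pow_const
            4).aemeasurable)
          ((continuous_enorm.measurable.pow_const 4).aemeasurable)
    _ ≤ _ := by
        gcongr
        exact (lintegral_le_sobolevNormPow hg).2.2

omit he

/-- The integrand of the finite-dimensional part is at most `‖M‖ ‖∇ gap‖ ‖x‖`; Cauchy-Schwarz pairs
the gap with the fourth moment of `μ`. -/
theorem lintegral_drift_sub_hgno_le (hvL : ∀ x, ∇ v x ∈ L.domain) (heL : ∀ i, e i ∈ L.domain)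
    {M : EuclideanSpace ℝ (Fin d) →L[ℝ] H}
    (hM : ∀ y, opApply L ((coordL e d).adjoint y) = M y) :
    ∫⁻ x, ‖⟪opApply L (∇ v x - ∇ (hgno e f) x), x⟫‖ₑ ^ 2 ∂μ ≤
      2 ^ 2 * (∫⁻ x, ‖consistencyError L e v d x‖ₑ ^ 2 ∂μ
        + ‖M‖ₑ ^ 2 * (∫⁻ x, ‖x‖ₑ ^ 4 ∂μ) ^ (1 / 2 : ℝ)
          * sobolevNormPow 4 (μ.map (coordL e d)) (galerkinGap e v f) ^ (1 / 2 : ℝ)) := by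
  have hg := contDiff_galerkinGap (e := e) hv hf
  have hgc := (continuous_gradient hg).comp (coordL e d).continuous
  simp only [inner_opApply_sub_hgno hv hvL heL hf hM]
  refine (lintegral_enorm_add_pow_le
    (((M.continuous.comp hgc).inner continuous_id).enorm.measurable) 2).trans ?_
  gcongr
  calc _ ≤ ∫⁻ x, ‖M‖ₑ ^ 2 * (‖∇ (galerkinGap e v f) (coordL e d x)‖ₑ * ‖x‖ₑ) ^ 2 ∂μ := by
        refine lintegral_mono fun x => ?_
        rw [← mul_pow, ← mul_assoc]
        gcongr
        rw [← enorm_norm M, ← enorm_norm (∇ _ _), ← enorm_norm x, ← enorm_mul, ← enorm_mul]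
        refine enorm_le_iff_norm_le.2 (le_trans ?_ (le_abs_self _))
        exact (abs_real_inner_le_norm _ _).trans (by gcongr; exact M.le_opNorm _)
    _ = ‖M‖ₑ ^ 2 * ∫⁻ x, (‖∇ (galerkinGap e v f) (coordL e d x)‖ₑ * ‖x‖ₑ) ^ 2 ∂μ :=
        lintegral_const_mul' _ _ (by simp)
    _ ≤ ‖M‖ₑ ^ 2 * ((∫⁻ x, ‖∇ (galerkinGap e v f) (coordL e d x)‖ₑ ^ 4 ∂μ) ^ (1 / 2 : ℝ)
          * (∫⁻ x, ‖x‖ₑ ^ 4 ∂μ) ^ (1 / 2 : ℝ)) := by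
        gcongr
        exact lintegral_mul_sq_le hgc.enorm.measurable continuous_enorm.measurable
    _ ≤ ‖M‖ₑ ^ 2 * (sobolevNormPow 4 (μ.map (coordL e d)) (galerkinGap e v f) ^ (1 / 2 : ℝ)
          * (∫⁻ x, ‖x‖ₑ ^ 4 ∂μ) ^ (1 / 2 : ℝ)) := by
        gcongr
        exact (lintegral_le_sobolevNormPow hg).2.1
    _ = _ := by ring

include he

theorem lintegral_nonlinearity_trunc_sub_hgno_le (hk : 0 ≤ k) {C : ℝ} (hC : 0 ≤ C)
    (hF : ∀ (x : H) (v r : ℝ) (p q : H) (Z Y : SymOp H),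
      |F x v p Z - F x r q Y| ≤ C * (|v - r| + ‖p - q‖ + ‖Z - Y‖) * (1 + ‖x‖ ^ k)) :
    ∫⁻ x, ‖F x (trunc e v d x) (∇ (trunc e v d) x) (hess (trunc e v d) x)
        - F x (hgno e f x) (∇ (hgno e f) x) (hess (hgno e f) x)‖ₑ ^ 2 ∂μ ≤
      ‖C‖ₑ ^ 2 * (4 ^ 4) ^ (1 / 2 : ℝ) * (∫⁻ x, ‖1 + ‖x‖ ^ k‖ₑ ^ 4 ∂μ) ^ (1 / 2 : ℝ)
        * sobolevNormPow 4 (μ.map (coordL e d)) (galerkinGap e v f) ^ (1 / 2 : ℝ) := by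
  have hg := contDiff_galerkinGap (e := e) hv hf
  have hc1 : Continuous fun x => galerkinGap e v f (coordL e d x) :=
    hg.continuous.comp (coordL e d).continuous
  have hc2 : Continuous fun x => ∇ (galerkinGap e v f) (coordL e d x) :=
    (continuous_gradient hg).comp (coordL e d).continuous
  have hc3 : Continuous fun x => hessOp (galerkinGap e v f) (coordL e d x) :=
    (continuous_hessOp hg).comp (coordL e d).continuous
  set a : H → ℝ≥0∞ := fun x => ‖galerkinGap e v f (coordL e d x)‖ₑ with ha
  set b : H → ℝ≥0∞ := fun x => ‖∇ (galerkinGap e v f) (coordL e d x)‖ₑ with hb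
  set c : H → ℝ≥0∞ := fun x => ‖hessOp (galerkinGap e v f) (coordL e d x)‖ₑ with hc
  have hsum : ∫⁻ x, (a x + b x + c x) ^ 4 ∂μ ≤
      4 ^ 4 * sobolevNormPow 4 (μ.map (coordL e d)) (galerkinGap e v f) := by
    rw [sobolevNormPow_map 4 hg, ← lintegral_const_mul' _ _ (by simp)]
    refine lintegral_mono fun x => ?_
    calc (a x + b x + c x) ^ 4 ≤ 2 ^ 4 * (2 ^ 4 * (a x ^ 4 + b x ^ 4) + c x ^ 4) := by
          refine (ENNReal.add_pow_le_two_pow_mul _ _ 4).trans ?_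
          gcongr
          exact ENNReal.add_pow_le_two_pow_mul _ _ 4
      -- The last term is enlarged to share the factor `2 ^ 4`, whence `2 ^ 4 * 2 ^ 4 = 4 ^ 4`.
      _ ≤ 2 ^ 4 * (2 ^ 4 * (a x ^ 4 + b x ^ 4) + 2 ^ 4 * c x ^ 4) := by
          gcongr
          exact le_mul_of_one_le_left' (by norm_num)
      _ = 4 ^ 4 * (a x ^ 4 + b x ^ 4 + c x ^ 4) := by ring
  calc _ ≤ ∫⁻ x, ‖C‖ₑ ^ 2 * ((a x + b x + c x) * ‖1 + ‖x‖ ^ k‖ₑ) ^ 2 ∂μ := by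
        refine lintegral_mono fun x => ?_
        rw [← mul_pow, ← mul_assoc]
        gcongr
        refine (enorm_le_iff_norm_le.2 ((abs_nonlinearity_trunc_sub_hgno_le hC hF he hv hf x).trans
          (Real.le_norm_self _))).trans ?_
        rw [enorm_mul, enorm_mul]
        gcongr
        refine (enorm_add_le _ _).trans ?_
        gcongr
        · refine (enorm_add_le _ _).trans ?_
          rw [← Real.norm_eq_abs, enorm_norm, enorm_norm]
        · rw [enorm_norm]
    _ = ‖C‖ₑ ^ 2 * ∫⁻ x, ((a x + b x + c x) * ‖1 + ‖x‖ ^ k‖ₑ) ^ 2 ∂μ :=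
        lintegral_const_mul' _ _ (by simp)
    _ ≤ ‖C‖ₑ ^ 2 * ((∫⁻ x, (a x + b x + c x) ^ 4 ∂μ) ^ (1 / 2 : ℝ)
          * (∫⁻ x, ‖1 + ‖x‖ ^ k‖ₑ ^ 4 ∂μ) ^ (1 / 2 : ℝ)) := by
        gcongr
        exact lintegral_mul_sq_le
          ((hc1.enorm.measurable.add hc2.enorm.measurable).add hc3.enorm.measurable)
          (continuous_weight hk).enorm.measurable
    _ ≤ ‖C‖ₑ ^ 2 * ((4 ^ 4 * sobolevNormPow 4 (μ.map (coordL e d)) (galerkinGap e v f))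
          ^ (1 / 2 : ℝ) * (∫⁻ x, ‖1 + ‖x‖ ^ k‖ₑ ^ 4 ∂μ) ^ (1 / 2 : ℝ)) := by
        gcongr
    _ = _ := by
        rw [ENNReal.mul_rpow_of_nonneg _ _ (by norm_num)]
        ring

omit he

theorem lintegral_pdeResidual_hgno_le {k : ℝ} (hFlip : LipschitzWithWeight F k)
    (hsol : IsClassicalSolution L F v) (heL : ∀ i, e i ∈ L.domain) :
    ∫⁻ x, ‖pdeResidual L F (hgno e f) x‖ₑ ^ 2 ∂μ ≤
      2 ^ 2 * (2 ^ 2 * (∫⁻ x, ‖F x (trunc e v d x) (∇ (trunc e v d) x) (hess (trunc e v d) x)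
          - F x (v x) (∇ v x) (hess v x)‖ₑ ^ 2 ∂μ
        + ∫⁻ x, ‖F x (trunc e v d x) (∇ (trunc e v d) x) (hess (trunc e v d) x)
          - F x (hgno e f x) (∇ (hgno e f) x) (hess (hgno e f) x)‖ₑ ^ 2 ∂μ)
        + ∫⁻ x, ‖⟪opApply L (∇ v x - ∇ (hgno e f) x), x⟫‖ₑ ^ 2 ∂μ) := by
  have hm1 : Measurable fun x => ‖F x (hgno e f x) (∇ (hgno e f) x) (hess (hgno e f) x)
      - F x (trunc e v d x) (∇ (trunc e v d) x) (hess (trunc e v d) x)‖ₑ :=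
    ((continuous_nonlinearity hFlip (contDiff_hgno hf)).sub
      (continuous_nonlinearity hFlip (contDiff_trunc hv d))).enorm.measurable
  have hm2 : Measurable fun x => ‖F x (hgno e f x) (∇ (hgno e f) x) (hess (hgno e f) x)
      - F x (v x) (∇ v x) (hess v x)‖ₑ :=
    ((continuous_nonlinearity hFlip (contDiff_hgno hf)).sub
      (continuous_nonlinearity hFlip hv)).enorm.measurable
  -- The drift takes the slot without a measurability condition; the differences of `F` are
  -- continuous.
  have h1 := lintegral_enorm_add_pow_le (μ := μ)
    (f := fun x => -⟪opApply L (∇ v x - ∇ (hgno e f) x), x⟫) hm2 2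
  have h2 := lintegral_enorm_add_pow_le (μ := μ)
    (f := fun x => F x (trunc e v d x) (∇ (trunc e v d) x) (hess (trunc e v d) x)
      - F x (v x) (∇ v x) (hess v x)) hm1 2
  have h3 : ∀ x, pdeResidual L F (hgno e f) x = -⟪opApply L (∇ v x - ∇ (hgno e f) x), x⟫
      + (F x (hgno e f x) (∇ (hgno e f) x) (hess (hgno e f) x) - F x (v x) (∇ v x) (hess v x)) :=
    fun x => by rw [pdeResidual_hgno hsol heL hf]; ring
  simp only [← h3, enorm_neg] at h1
  refine h1.trans ?_
  rw [add_comm (∫⁻ x, ‖⟪_, x⟫‖ₑ ^ 2 ∂μ)]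
  gcongr
  convert! h2 using 5 with x
  · ring_nf
  · rw [← enorm_neg, neg_sub]

end GalerkinErrors

end

/-! ### Part (ii): choice of dimension and parameter -/

noncomputable section

theorem ENNReal.exists_pos_forall_lt_ofReal {P : ℝ≥0∞ → Prop} (hP : ∀ᶠ s in 𝓝 0, P s) :
    ∃ δ : ℝ, 0 < δ ∧ ∀ s < ENNReal.ofReal δ, P s := by
  obtain ⟨a, ha, h⟩ := ENNReal.nhds_zero_basis.eventually_iff.1 hP
  obtain ⟨δ, _, h1, h2⟩ := ENNReal.lt_iff_exists_real_btwn.1 ha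
  exact ⟨δ, ENNReal.ofReal_pos.1 h1, fun s hs => h (hs.trans h2)⟩

variable {H : Type*} [NormedAddCommGroup H] [InnerProductSpace ℝ H] [CompleteSpace H]
  {e : ℕ → H} {N : ℕ∞} {v : H → ℝ} {L : H →ₗ.[ℝ] H} {F : H → ℝ → H → SymOp H → ℝ}

theorem exists_hgno_mean_approx [TopologicalSpace.SeparableSpace H] [Nontrivial H]
    [MeasurableSpace H] [BorelSpace H] {k : ℝ} (hk : 0 ≤ k)
    (hFlip : LipschitzWithWeight F k) (hFseq : SeqContinuousCompactOpen F)
    (he : IsOrthonormalBasisSeq e N) (heL : ∀ i, e i ∈ L.domain)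
    {Θ : ℕ → Type*} {net : (d : ℕ) → Θ d → EuclideanSpace ℝ (Fin d) → ℝ}
    (hnet : ∀ d : ℕ, 1 ≤ d → ∀ θ : Θ d, ContDiff ℝ 2 (net d θ))
    (hv : IsClassicalSolution L F v) (huniv : UniversalInSobolev 4 net)
    (hgrowth : ∃ C : ℝ, 0 < C ∧ ∀ x, |v x| + ‖∇ v x‖ + ‖hessOp v x‖ ≤ C * (1 + ‖x‖ ^ k))
    {μ μ' : Measure H} [IsFiniteMeasure μ] [SFinite μ']
    (hμk : Integrable (fun x => ‖x‖ ^ (4 * k)) μ) (hμ : Integrable (fun x => ‖x‖ ^ 4) μ)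
    (hμ' : Integrable (fun x => ‖x‖ ^ 4) μ')
    (hcons : Tendsto (fun d : ℕ => ∫⁻ x, ‖consistencyError L e v d x‖ₑ ^ 2 ∂μ) atTop (𝓝 0))
    {ε : ℝ} (hε : 0 < ε) :
    ∃ d : ℕ, 1 ≤ d ∧ (d : ℕ∞) ≤ N ∧ ∃ θ : Θ d,
      ContDiff ℝ 2 (hgno e (net d θ)) ∧
      (∀ x, ∇ (hgno e (net d θ)) x ∈ L.domain) ∧
      ∫⁻ x, ‖v x - hgno e (net d θ) x‖ₑ ^ 4 ∂μ < ENNReal.ofReal ε ∧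
      ∫⁻ x, ‖∇ v x - ∇ (hgno e (net d θ)) x‖ₑ ^ 4 ∂μ < ENNReal.ofReal ε ∧
      ∫⁻ z : H × H, ‖(hessOp v z.1 - hessOp (hgno e (net d θ)) z.1) z.2‖ₑ ^ 4 ∂(μ.prod μ')
        < ENNReal.ofReal ε ∧
      ∫⁻ x, ‖⟪opApply L (∇ v x - ∇ (hgno e (net d θ)) x), x⟫‖ₑ ^ 2 ∂μ < ENNReal.ofReal ε ∧
      ∫⁻ x, ‖pdeResidual L F (hgno e (net d θ)) x‖ₑ ^ 2 ∂μ < ENNReal.ofReal ε := by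
  have hv2 := hv.contDiff
  obtain ⟨C, hC, hgrowth⟩ := hgrowth
  have hJ := lintegral_weight_lt_top hk hμk
  have hI : ∫⁻ x, ‖x‖ₑ ^ 4 ∂μ < ∞ :=
    lt_of_eq_of_lt (lintegral_congr fun x => by rw [enorm_pow, enorm_norm]) hμ.2
  have hI' : ∫⁻ x, ‖x‖ₑ ^ 4 ∂μ' < ∞ :=
    lt_of_eq_of_lt (lintegral_congr fun x => by rw [enorm_pow, enorm_norm]) hμ'.2
  -- The residual is the costliest: two truncation errors, each multiplied by `2 ^ 4`, give `32 * ε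
  -- / 64 = ε / 2` and leave room for the gap.
  have hη : (0 : ℝ≥0∞) < ENNReal.ofReal (ε / 64) := ENNReal.ofReal_pos.2 (by positivity)
  have hsmall : ∀ {A : ℕ → ℝ≥0∞}, Tendsto A atTop (𝓝 0) →
      ∀ᶠ d in atTop, A d < ENNReal.ofReal (ε / 64) := fun hA => hA.eventually_lt_const hη
  simp only [consistencyError_eq hv2] at hcons
  obtain ⟨d, hd1, hdN, h1, h2, h3, h4, h5⟩ := he.exists_le_of_eventually
    (Q := fun T => ∫⁻ x, ‖v x - v (T x)‖ₑ ^ 4 ∂μ < ENNReal.ofReal (ε / 64) ∧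
      ∫⁻ x, ‖∇ v x - ∇ (fun z => v (T z)) x‖ₑ ^ 4 ∂μ < ENNReal.ofReal (ε / 64) ∧
      ∫⁻ z : H × H, ‖(hessOp v z.1 - hessOp (fun z => v (T z)) z.1) z.2‖ₑ ^ 4 ∂(μ.prod μ')
        < ENNReal.ofReal (ε / 64) ∧
      ∫⁻ x, ‖F x (v (T x)) (∇ (fun z => v (T z)) x) (hess (fun z => v (T z)) x)
        - F x (v x) (∇ v x) (hess v x)‖ₑ ^ 2 ∂μ < ENNReal.ofReal (ε / 64) ∧
      ∫⁻ x, ‖⟪opApply L (∇ v x - ∇ (fun z => v (T z)) x), x⟫‖ₑ ^ 2 ∂μ < ENNReal.ofReal (ε / 64))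
    ((hsmall (tendsto_lintegral_sub_trunc he hv2 hk hC hgrowth hJ)).and
      ((hsmall (tendsto_lintegral_gradient_sub_trunc he hv2 hk hC hgrowth hJ)).and
      ((hsmall (tendsto_lintegral_hessOp_sub_trunc he hv2 hk hC hgrowth hJ hI')).and
      ((hsmall (tendsto_lintegral_nonlinearity_sub_trunc he hv2 hk hC hgrowth hJ hFlip hFseq)).and
      (hsmall hcons)))))
  change ∫⁻ x, ‖v x - trunc e v d x‖ₑ ^ 4 ∂μ < ENNReal.ofReal (ε / 64) at h1
  change ∫⁻ x, ‖∇ v x - ∇ (trunc e v d) x‖ₑ ^ 4 ∂μ < ENNReal.ofReal (ε / 64) at h2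
  change ∫⁻ z : H × H, ‖(hessOp v z.1 - hessOp (trunc e v d) z.1) z.2‖ₑ ^ 4 ∂(μ.prod μ')
    < ENNReal.ofReal (ε / 64) at h3
  change ∫⁻ x, ‖F x (trunc e v d x) (∇ (trunc e v d) x) (hess (trunc e v d) x)
    - F x (v x) (∇ v x) (hess v x)‖ₑ ^ 2 ∂μ < ENNReal.ofReal (ε / 64) at h4
  change ∫⁻ x, ‖⟪opApply L (∇ v x - ∇ (trunc e v d) x), x⟫‖ₑ ^ 2 ∂μ
    < ENNReal.ofReal (ε / 64) at h5
  simp only [← consistencyError_eq hv2] at h5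
  obtain ⟨C', hC', hF⟩ := hFlip.2
  obtain ⟨M, hM⟩ := exists_clm_opApply heL d
  set A₁ := ∫⁻ x, ‖v x - trunc e v d x‖ₑ ^ 4 ∂μ
  set A₂ := ∫⁻ x, ‖∇ v x - ∇ (trunc e v d) x‖ₑ ^ 4 ∂μ
  set A₃ := ∫⁻ z : H × H, ‖(hessOp v z.1 - hessOp (trunc e v d) z.1) z.2‖ₑ ^ 4 ∂(μ.prod μ')
  set A₄ := ∫⁻ x, ‖F x (trunc e v d x) (∇ (trunc e v d) x) (hess (trunc e v d) x)
    - F x (v x) (∇ v x) (hess v x)‖ₑ ^ 2 ∂μ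
  set A₅ := ∫⁻ x, ‖consistencyError L e v d x‖ₑ ^ 2 ∂μ
  set m := ‖M‖ₑ ^ 2 * (∫⁻ x, ‖x‖ₑ ^ 4 ∂μ) ^ (1 / 2 : ℝ)
  set q := ‖C'‖ₑ ^ 2 * (4 ^ 4) ^ (1 / 2 : ℝ) * (∫⁻ x, ‖1 + ‖x‖ ^ k‖ₑ ^ 4 ∂μ) ^ (1 / 2 : ℝ)
  set I' := ∫⁻ h, ‖h‖ₑ ^ 4 ∂μ'
  have hm : m ≠ ∞ := ENNReal.mul_ne_top (ENNReal.pow_ne_top enorm_ne_top)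
    (ENNReal.rpow_ne_top_of_nonneg (by norm_num) hI.ne)
  have hq : q ≠ ∞ := ENNReal.mul_ne_top (ENNReal.mul_ne_top (ENNReal.pow_ne_top enorm_ne_top)
    (ENNReal.rpow_ne_top_of_nonneg (by norm_num) (by norm_num)))
    (ENNReal.rpow_ne_top_of_nonneg (by norm_num) hJ.ne)
  have hscale : ENNReal.ofReal ε = 64 * ENNReal.ofReal (ε / 64) := by
    rw [← ENNReal.ofReal_ofNat, ← ENNReal.ofReal_mul (by norm_num)]
    congr 1
    ring
  have hlt : ∀ {a : ℝ≥0∞}, a < ENNReal.ofReal (ε / 64) → 2 ^ 4 * a < ENNReal.ofReal ε := by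
    intro a ha
    rw [hscale]
    refine (ENNReal.mul_lt_mul_right (by norm_num) (by norm_num) ha).trans_le ?_
    gcongr
    norm_num
  have hsqrt : Tendsto (fun s : ℝ≥0∞ => s ^ (1 / 2 : ℝ)) (𝓝 0) (𝓝 0) := by
    simpa using (ENNReal.continuous_rpow_const (y := (1 / 2 : ℝ))).tendsto 0
  have hmul : ∀ {c : ℝ≥0∞} {l : ℝ≥0∞ → ℝ≥0∞}, c ≠ ∞ → Tendsto l (𝓝 0) (𝓝 0) →
      Tendsto (fun s => c * l s) (𝓝 0) (𝓝 0) := fun hc hl => by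
    simpa using ENNReal.Tendsto.const_mul hl (Or.inr hc)
  have hlin : ∀ {a : ℝ≥0∞} {l : ℝ≥0∞ → ℝ≥0∞}, a < ENNReal.ofReal (ε / 64) →
      Tendsto l (𝓝 0) (𝓝 0) → ∀ᶠ s in 𝓝 0, 2 ^ 4 * (a + l s) < ENNReal.ofReal ε := by
    intro a l ha hl
    have h := ENNReal.Tendsto.const_mul (a := 2 ^ 4) (hl.const_add a) (Or.inr (by norm_num))
    rw [add_zero] at h
    exact h.eventually_lt_const (hlt ha)
  have hres : ∀ᶠ s : ℝ≥0∞ in 𝓝 0, 2 ^ 2 * (2 ^ 2 * (A₄ + q * s ^ (1 / 2 : ℝ))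
      + 2 ^ 2 * (A₅ + m * s ^ (1 / 2 : ℝ))) < ENNReal.ofReal ε := by
    have h : Tendsto (fun s : ℝ≥0∞ => 2 ^ 2 * (2 ^ 2 * (A₄ + q * s ^ (1 / 2 : ℝ))
        + 2 ^ 2 * (A₅ + m * s ^ (1 / 2 : ℝ)))) (𝓝 0)
        (𝓝 (2 ^ 2 * (2 ^ 2 * (A₄ + 0) + 2 ^ 2 * (A₅ + 0)))) :=
      ENNReal.Tendsto.const_mul ((ENNReal.Tendsto.const_mul ((hmul hq hsqrt).const_add A₄)
        (Or.inr (by norm_num))).add (ENNReal.Tendsto.const_mul ((hmul hm hsqrt).const_add A₅)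
        (Or.inr (by norm_num)))) (Or.inr (by norm_num))
    refine h.eventually_lt_const ?_
    have h6 : (2 : ℝ≥0∞) ^ 2 * (2 ^ 2 * (A₄ + 0) + 2 ^ 2 * (A₅ + 0)) = 2 ^ 4 * (A₄ + A₅) := by ring
    have h7 : ENNReal.ofReal ε = 2 ^ 5 * (ENNReal.ofReal (ε / 64) + ENNReal.ofReal (ε / 64)) := by
      rw [hscale]; ring
    rw [h6, h7]
    refine (ENNReal.mul_lt_mul_right (by norm_num) (by norm_num)
      (ENNReal.add_lt_add h4 h5)).trans_le ?_
    gcongr <;> norm_num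
  -- With `d` fixed, each error bound is a function of the Sobolev gap `s` whose limit at `s = 0` is
  -- below `ε`, so a small `s` suffices and no explicit `δ` is needed.
  obtain ⟨δ, hδ, hδP⟩ := ENNReal.exists_pos_forall_lt_ofReal
    ((hlin h1 tendsto_id).and ((hlin h2 tendsto_id).and
      ((hlin h3 (hmul hI'.ne tendsto_id)).and ((hlin h5 (hmul hm hsqrt)).and hres))))
  obtain ⟨θ, hθ⟩ := huniv d hd1 (μ.map (coordL e d)) inferInstance _
    (contDiff_restrict (e := e) hv2 d)
    (sobolevNormPow_restrict_lt_top hk he hv2 hC hgrowth hJ d) δ hδ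
  change sobolevNormPow 4 (μ.map (coordL e d)) (galerkinGap e v (net d θ)) < _ at hθ
  have hf := hnet d hd1 θ
  obtain ⟨b1, b2, b3, b4, b5⟩ := hδP _ hθ
  have hdrift := lintegral_drift_sub_hgno_le (μ := μ) hv2 hf hv.gradient_mem heL hM
  refine ⟨d, hd1, hdN, θ, contDiff_hgno hf, gradient_hgno_mem heL hf,
    (lintegral_sub_hgno_le hv2 hf).trans_lt b1,
    (lintegral_gradient_sub_hgno_le he hv2 hf).trans_lt b2,
    (lintegral_hessOp_sub_hgno_le he hv2 hf).trans_lt ?_,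
    hdrift.trans_lt (lt_of_le_of_lt ?_ b4),
    (lintegral_pdeResidual_hgno_le hv2 hf hFlip hv heL).trans_lt (lt_of_le_of_lt ?_ b5)⟩
  · rwa [mul_comm I'] at b3
  · gcongr <;> norm_num
  · gcongr
    exact lintegral_nonlinearity_trunc_sub_hgno_le he hv2 hf hk hC'.le hF

end

theorem mainTheorem4 {H : Type*} [NormedAddCommGroup H] [InnerProductSpace ℝ H] [CompleteSpace H]
    [TopologicalSpace.SeparableSpace H] [Nontrivial H] [MeasurableSpace H] [BorelSpace H]
    -- the unbounded operator and the nonlinearity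
    (L : H →ₗ.[ℝ] H) (hLclosed : L.IsClosed) (hLdense : Dense (L.domain : Set H))
    (F : H → ℝ → H → SymOp H → ℝ) (k : ℝ) (hk : 0 ≤ k)
    (hFlip : LipschitzWithWeight F k) (hFseq : SeqContinuousCompactOpen F)
    -- an orthonormal basis contained in the domain of `L`
    (e : ℕ → H) (N : ℕ∞) (he : IsOrthonormalBasisSeq e N) (heL : ∀ i, e i ∈ L.domain)
    -- the finite-dimensional approximating functions
    {Θ : ℕ → Type*} (net : (d : ℕ) → Θ d → EuclideanSpace ℝ (Fin d) → ℝ)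
    (hnet : ∀ d : ℕ, 1 ≤ d → ∀ θ : Θ d, ContDiff ℝ 2 (net d θ))
    -- a classical solution
    (v : H → ℝ) (hv : IsClassicalSolution L F v) :
    -- (i) uniform approximation on compact sets
    (UniversalOnCompacts net →
      ∀ K K' : Set H, IsCompact K → IsCompact K' →
      (∀ η : ℝ, 0 < η → ∀ᶠ d : ℕ in atTop, ∀ x ∈ K, |consistencyError L e v d x| < η) →
      ∀ ε : ℝ, 0 < ε → ∃ d : ℕ, 1 ≤ d ∧ (d : ℕ∞) ≤ N ∧ ∃ θ : Θ d,
        ContDiff ℝ 2 (hgno e (net d θ)) ∧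
        (∀ x, ∇ (hgno e (net d θ)) x ∈ L.domain) ∧
        (∀ x ∈ K, |v x - hgno e (net d θ) x| < ε) ∧
        (∀ x ∈ K, ‖∇ v x - ∇ (hgno e (net d θ)) x‖ < ε) ∧
        (∀ x ∈ K, ∀ h ∈ K', ‖(hessOp v x - hessOp (hgno e (net d θ)) x) h‖ < ε) ∧
        (∀ x ∈ K, |⟪opApply L (∇ v x - ∇ (hgno e (net d θ)) x), x⟫| < ε) ∧
        (∀ x ∈ K, |pdeResidual L F (hgno e (net d θ)) x| < ε)) ∧
    -- (ii) approximation in the mean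
    (UniversalInSobolev 4 net →
      (∃ C : ℝ, 0 < C ∧ ∀ x, |v x| + ‖∇ v x‖ + ‖hessOp v x‖ ≤ C * (1 + ‖x‖ ^ k)) →
      ∀ μ μ' : Measure H, IsProbabilityMeasure μ → IsProbabilityMeasure μ' →
      Integrable (fun x => ‖x‖ ^ (4 * k)) μ → Integrable (fun x => ‖x‖ ^ 4) μ →
      Integrable (fun x => ‖x‖ ^ 4) μ' →
      Tendsto (fun d : ℕ => ∫⁻ x, ‖consistencyError L e v d x‖ₑ ^ 2 ∂μ) atTop (𝓝 0) →
      ∀ ε : ℝ, 0 < ε → ∃ d : ℕ, 1 ≤ d ∧ (d : ℕ∞) ≤ N ∧ ∃ θ : Θ d,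
        ContDiff ℝ 2 (hgno e (net d θ)) ∧
        (∀ x, ∇ (hgno e (net d θ)) x ∈ L.domain) ∧
        ∫⁻ x, ‖v x - hgno e (net d θ) x‖ₑ ^ 4 ∂μ < ENNReal.ofReal ε ∧
        ∫⁻ x, ‖∇ v x - ∇ (hgno e (net d θ)) x‖ₑ ^ 4 ∂μ < ENNReal.ofReal ε ∧
        ∫⁻ z : H × H, ‖(hessOp v z.1 - hessOp (hgno e (net d θ)) z.1) z.2‖ₑ ^ 4 ∂(μ.prod μ')
          < ENNReal.ofReal ε ∧
        ∫⁻ x, ‖⟪opApply L (∇ v x - ∇ (hgno e (net d θ)) x), x⟫‖ₑ ^ 2 ∂μ < ENNReal.ofReal ε ∧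
        ∫⁻ x, ‖pdeResidual L F (hgno e (net d θ)) x‖ₑ ^ 2 ∂μ < ENNReal.ofReal ε) := by
  exact ⟨fun huniv K K' hK hK' hcons ε hε =>
      exists_hgno_uniform_approx hk hFlip hFseq he heL hnet hv huniv hK hK' hcons hε,
    fun huniv hgrowth μ μ' _ _ hμk hμ hμ' hcons ε hε =>
      exists_hgno_mean_approx hk hFlip hFseq he heL hnet hv huniv hgrowth hμk hμ hμ' hcons hε⟩
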